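/- Let $p$ be a prime, $N\ge 1$ an integer with $p\nmid N$, $\chi$ a Dirichlet character modulo $N$, and let $f(z)=\sum_{n\ge1}a(n)e^{2\pi i n z}$, $a(1)=1$, be a normalised cusp form of weight $k$ and character $\chi$ on $\Gamma_0(N)$ (that is, $f\in S_k(\Gamma_1(N))$ and $f\left(\frac{az+b}{cz+d}\right)=\chi(d)(cz+d)^kf(z)$ on $\Gamma_0(N)$) that is an eigenvector of all Hecke operators $T(q)$, $q$ prime. Let $a_1,a_2\in\mathbb{C}$ satisfy $a_1+a_2=a(p)$, $a_1a_2=\chi(p)p^{k-1}$, and put $$L_{(p)}(s,f)=\frac{1}{1-a(p)p^{-s}+\chi(p)p^{k-1}p^{-2s}}=\frac{1}{(1-a_1p^{-s})(1-a_2p^{-s})}.$$ On $\mathbb{Q}_p$, with Haar measure normalised by $\mathrm{vol}(\mathbb{Z}_p)=1$, let $\psi_n(\xi)=p^{-n/2}e^{2\pi i p^{n-1}\xi}\,\mathbf 1_{\mathbb{Z}_p}(p^n\xi)$ $(n\in\mathbb{Z})$, which are orthonormal in $L^2(\mathbb{Q}_p)$, write $|m\rangle=\psi_{1-m}$, and let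 $\mathcal H_-$ be the closed span of $\{|m\rangle: m\ge 0\}$. Let $a_\pm$ be the bounded operators on $\mathcal H_-$ with $a_-|m\rangle=|m+1\rangle$, $a_+|m+1\rangle=|m\rangle$, $a_+|0\rangle=0$. For $i=1,2$ let $\mathfrak a_i(p^n)=a_i^n$ $(n\in\mathbb{Z})$. (As $p\nmid N$, $a_1$ and $a_2$ are nonzero.) Let $$\Gamma_{(\mathfrak a_i,f)}(s)=\int_{\mathbb{Q}_p}e^{2\pi i\xi}|\xi|_p^{s-1}\mathfrak a_i(|\xi|_p^{-1})\,d\xi ,$$ defined for $|a_i|<p^{\mathrm{Re}\, s}$ as the limit of the integrals over the balls $|\xi|_p\le p^M$, $M\to\infty$, and by analytic continuation otherwise, and let $$D^{\alpha}_{(\mathfrak a_i,f)}g(\xi)=\frac{1}{\Gamma_{(\mathfrak a_i,f)}(-\alpha)}\int_{\mathbb{Q}_p}\frac{g(\xi')-g(\xi)}{|\xi'-\xi|_p^{\alpha+1}}\,\mathfrak a_i(|\xi'-\xi|_p^{-1})\,d\xi',$$ defined by this integral for $|a_i|\,p^{\mathrm{Re}\,\alpha}>1$ and by analytic continuation in $\alpha$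 otherwise. Let $s\in\mathbb{C}$ satisfy $|a_1p^{-s}|<1$ and $|a_2p^{-s}|<1$; this holds in particular whenever $\mathrm{Re}\, s>1+\frac k2$. Then each $D^{-s}_{(\mathfrak a_i,f)}$, defined on the wavelets $|m\rangle$, $m\ge0$, extends to a (unique) bounded operator on $\mathcal H_-$, and for every integer $\ell\ge0$ the operator below on the Hilbert space tensor product $\mathcal H_-\otimes\mathcal H_-$ is of trace class, with $$\mathrm{Tr}\left(\sum_{j=0}^{\ell}a_+^{j}D^{-s}_{(\mathfrak a_1,f)}a_-^{j}\otimes a_+^{\ell-j}D^{-s}_{(\mathfrak a_2,f)}a_-^{\ell-j}\right)=\left(\sum_{j=0}^{\ell}a_1^{j}a_2^{\ell-j}\right)p^{-s\ell}L_{(p)}(s,f)=a(p^\ell)\,p^{-s\ell}L_{(p)}(s,f),$$ where moreover $a(p^\ell)=\sum_{j=0}^{\ell}a_1^{j}a_2^{\ell-j}$. -/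

import Mathlib

open MeasureTheory
open scoped ENNReal

namespace PadicHecke

section Character
variable (p : ℕ) [Fact p.Prime]

/-- Every `p`-adic number is congruent modulo `ℤ_p` to a fraction `m / p ^ n`. -/
theorem exists_fracPart (ξ : ℚ_[p]) :
    ∃ q : ℚ, (∃ m n : ℕ, q = (m : ℚ) / (p : ℚ) ^ n) ∧ ‖ξ - (q : ℚ_[p])‖ ≤ 1 := by
  have hp0 : (p : ℚ_[p]) ≠ 0 := by exact_mod_cast (Fact.out : p.Prime).ne_zero
  obtain ⟨n, hn⟩ : ∃ n : ℕ, ‖ξ‖ ≤ (p : ℝ) ^ n := by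
    obtain ⟨n, hn⟩ := pow_unbounded_of_one_lt ‖ξ‖
      (show (1 : ℝ) < p by exact_mod_cast (Fact.out : p.Prime).one_lt)
    exact ⟨n, hn.le⟩
  have hx : ‖(p : ℚ_[p]) ^ n * ξ‖ ≤ 1 := by
    rw [norm_mul, norm_pow, Padic.norm_p, inv_pow]
    have : (0 : ℝ) < (p : ℝ) ^ n := by
      have : (0 : ℝ) < p := by exact_mod_cast (Fact.out : p.Prime).pos
      positivity
    rw [inv_mul_le_iff₀ this]; simpa using hn
  let x : ℤ_[p] := ⟨(p : ℚ_[p]) ^ n * ξ, hx⟩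
  refine ⟨(x.appr n : ℚ) / (p : ℚ) ^ n, ⟨x.appr n, n, rfl⟩, ?_⟩
  have h1 : ‖x - x.appr n‖ ≤ (p : ℝ) ^ (-n : ℤ) :=
    (PadicInt.norm_le_pow_iff_mem_span_pow _ n).2 (PadicInt.appr_spec n x)
  have h2 : ξ - (((x.appr n : ℚ) / (p : ℚ) ^ n : ℚ) : ℚ_[p])
      = ((x - x.appr n : ℤ_[p]) : ℚ_[p]) / (p : ℚ_[p]) ^ n := by
    have : ((x : ℤ_[p]) : ℚ_[p]) = (p : ℚ_[p]) ^ n * ξ := rfl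
    push_cast
    rw [this]
    field_simp
  rw [h2, norm_div, norm_pow, Padic.norm_p, inv_pow, div_inv_eq_mul, ← PadicInt.norm_def]
  have h3 : (0 : ℝ) < (p : ℝ) ^ n := by
    have : (0 : ℝ) < p := by exact_mod_cast (Fact.out : p.Prime).pos
    positivity
  calc _ ≤ (p : ℝ) ^ (-n : ℤ) * (p : ℝ) ^ n := by gcongr
    _ = 1 := by rw [zpow_neg, zpow_natCast]; field_simp

/-- The fractional part of a `p`-adic number, a rational number `m / p ^ n` congruent to it modulo
`ℤ_p`; it is determined up to an integer. -/
noncomputable def fracPart (ξ : ℚ_[p]) : ℚ := (exists_fracPart p ξ).choose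

/-- The standard additive character `ξ ↦ e^{2πiξ}` of `ℚ_p`. -/
noncomputable def stdChar (ξ : ℚ_[p]) : ℂ :=
  Complex.exp (2 * Real.pi * Complex.I * (fracPart p ξ : ℂ))

/-- A fraction `m / p ^ n` (`m ∈ ℤ`) that is a `p`-adic integer is an integer. -/
theorem exists_int_of_norm_le_one (m : ℤ) (n : ℕ)
    (h : ‖(((m : ℚ) / (p : ℚ) ^ n : ℚ) : ℚ_[p])‖ ≤ 1) :
    ∃ z : ℤ, (m : ℚ) / (p : ℚ) ^ n = z := by
  have hp0 : (p : ℚ) ≠ 0 := by exact_mod_cast (Fact.out : p.Prime).ne_zero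
  have hpp : (0 : ℝ) < (p : ℝ) ^ n := by
    have : (0 : ℝ) < p := by exact_mod_cast (Fact.out : p.Prime).pos
    positivity
  have h1 : ‖(m : ℚ_[p])‖ ≤ (p : ℝ) ^ (-n : ℤ) := by
    push_cast at h
    rw [norm_div, norm_pow, Padic.norm_p, inv_pow, div_inv_eq_mul] at h
    rw [zpow_neg, zpow_natCast]
    rwa [← le_div_iff₀ hpp, one_div] at h
  rw [Padic.norm_int_le_pow_iff_dvd] at h1
  obtain ⟨z, hz⟩ := h1
  refine ⟨z, ?_⟩
  rw [hz]; push_cast; field_simp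

theorem stdChar_eq_of (ξ : ℚ_[p]) (q : ℚ) (hq : ∃ (m : ℤ) (n : ℕ), q = (m : ℚ) / (p : ℚ) ^ n)
    (h : ‖ξ - (q : ℚ_[p])‖ ≤ 1) :
    stdChar p ξ = Complex.exp (2 * Real.pi * Complex.I * (q : ℂ)) := by
  have hp0 : (p : ℚ) ≠ 0 := by exact_mod_cast (Fact.out : p.Prime).ne_zero
  obtain ⟨⟨m', n', e'⟩, h'⟩ := (exists_fracPart p ξ).choose_spec
  obtain ⟨m, n, e⟩ := hq
  have hd : ‖((fracPart p ξ - q : ℚ) : ℚ_[p])‖ ≤ 1 := by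
    have : ((fracPart p ξ - q : ℚ) : ℚ_[p]) = (ξ - q) - (ξ - (fracPart p ξ : ℚ)) := by
      push_cast; ring
    rw [this, sub_eq_add_neg]
    refine (Padic.nonarchimedean _ _).trans (max_le h ?_)
    rw [norm_neg]; exact h'
  have he : fracPart p ξ - q
      = (((m' : ℤ) * (p : ℤ) ^ n - m * (p : ℤ) ^ n' : ℤ) : ℚ) / (p : ℚ) ^ (n + n') := by
    have : fracPart p ξ = (m' : ℚ) / (p : ℚ) ^ n' := e'
    rw [this, e]; push_cast; field_simp; ring
  rw [he] at hd
  obtain ⟨z, hz⟩ := exists_int_of_norm_le_one p _ _ hd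
  rw [← he] at hz
  have : (fracPart p ξ : ℂ) = q + z := by
    have : fracPart p ξ = q + z := by linarith
    rw [this]; push_cast; rfl
  rw [stdChar, this, mul_add, Complex.exp_add]
  have : Complex.exp (2 * Real.pi * Complex.I * (z : ℂ)) = 1 := by
    rw [Complex.exp_eq_one_iff]; exact ⟨z, by ring⟩
  rw [this, mul_one]

theorem stdChar_eq_one (ξ : ℚ_[p]) (h : ‖ξ‖ ≤ 1) : stdChar p ξ = 1 := by
  rw [stdChar_eq_of p ξ 0 ⟨0, 0, by simp⟩ (by simpa using h)]; simp

theorem stdChar_add (ξ η : ℚ_[p]) : stdChar p (ξ + η) = stdChar p ξ * stdChar p η := by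
  have hp0 : (p : ℚ) ≠ 0 := by exact_mod_cast (Fact.out : p.Prime).ne_zero
  obtain ⟨⟨m, n, e⟩, h⟩ := (exists_fracPart p ξ).choose_spec
  obtain ⟨⟨m', n', e'⟩, h'⟩ := (exists_fracPart p η).choose_spec
  rw [stdChar_eq_of p (ξ + η) (fracPart p ξ + fracPart p η), stdChar, stdChar, ← Complex.exp_add]
  · push_cast; ring_nf
  · refine ⟨m * (p : ℤ) ^ n' + m' * (p : ℤ) ^ n, n + n', ?_⟩
    have h1 : fracPart p ξ = (m : ℚ) / (p : ℚ) ^ n := e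
    have h2 : fracPart p η = (m' : ℚ) / (p : ℚ) ^ n' := e'
    rw [h1, h2]; push_cast; field_simp; ring
  · have : ξ + η - ((fracPart p ξ + fracPart p η : ℚ) : ℚ_[p])
        = (ξ - (fracPart p ξ : ℚ)) + (η - (fracPart p η : ℚ)) := by push_cast; ring
    rw [this]
    exact (Padic.nonarchimedean _ _).trans (max_le h h')

theorem norm_stdChar (ξ : ℚ_[p]) : ‖stdChar p ξ‖ = 1 := by
  have : (2 * Real.pi * Complex.I * (fracPart p ξ : ℂ) : ℂ)
      = ((2 * Real.pi * (fracPart p ξ : ℝ) : ℝ) : ℂ) * Complex.I := by push_cast; ring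
  rw [stdChar, this, Complex.norm_exp_ofReal_mul_I]

theorem stdChar_inv_p_ne_one : stdChar p ((p : ℚ_[p])⁻¹) ≠ 1 := by
  have hp := (Fact.out : p.Prime)
  rw [stdChar_eq_of p _ (1 / (p : ℚ)) ⟨1, 1, by simp⟩ (by simp)]
  intro h
  rw [Complex.exp_eq_one_iff] at h
  obtain ⟨n, hn⟩ := h
  have h0 : (2 * Real.pi * Complex.I : ℂ) ≠ 0 := Complex.two_pi_I_ne_zero
  rw [mul_comm (n : ℂ)] at hn
  have h1 := mul_left_cancel₀ h0 hn
  have hpc : (p : ℂ) ≠ 0 := by exact_mod_cast hp.ne_zero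
  push_cast at h1
  have h2 : (n * p : ℂ) = 1 := by rw [← h1]; field_simp
  have h3 : n * (p : ℤ) = 1 := by exact_mod_cast h2
  have h4 : (p : ℤ) ∣ 1 := ⟨n, by rw [← h3]; ring⟩
  have h5 : p ∣ 1 := by exact_mod_cast h4
  exact hp.one_lt.ne' (Nat.dvd_one.1 h5)

theorem continuous_stdChar : Continuous (stdChar p) := by
  refine IsLocallyConstant.continuous ((IsLocallyConstant.iff_eventually_eq _).2 fun ξ => ?_)
  filter_upwards [Metric.closedBall_mem_nhds ξ one_pos] with η hη
  have : η = ξ + (η - ξ) := by ring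
  rw [this, stdChar_add, stdChar_eq_one p (η - ξ) (by simpa [dist_eq_norm] using hη), mul_one]

end Character

/-! ### Haar measure and the wavelets -/

/-- `ℚ_p` carries its Borel `σ`-algebra. -/
noncomputable instance instMeasurableSpacePadic (p : ℕ) [Fact p.Prime] : MeasurableSpace ℚ_[p] := borel _

instance instBorelSpacePadic (p : ℕ) [Fact p.Prime] : BorelSpace ℚ_[p] := ⟨rfl⟩

section Wavelets
variable (p : ℕ) [Fact p.Prime]

/-- The Haar measure on `ℚ_p` for which `ℤ_p = {ξ : |ξ|_p ≤ 1}` has measure `1`. -/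
noncomputable def haar : Measure ℚ_[p] :=
  Measure.addHaarMeasure
    ⟨⟨Metric.closedBall 0 1, isCompact_closedBall _ _⟩,
      ⟨0, mem_interior_iff_mem_nhds.2 (Metric.closedBall_mem_nhds 0 one_pos)⟩⟩

instance : (haar p).IsAddHaarMeasure := by unfold haar; infer_instance

/-- The Kozyrev wavelet `ψ_{n,0,1}(ξ) = p^{-n/2} e^{2πi p^{n-1} ξ} Ω(p^n ξ)`, where `Ω` is the
indicator function of `ℤ_p`. -/
noncomputable def wavelet (n : ℤ) (ξ : ℚ_[p]) : ℂ :=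
  (p : ℂ) ^ (-(n : ℂ) / 2) * stdChar p ((p : ℚ_[p]) ^ (n - 1) * ξ) *
    Set.indicator (Metric.closedBall (0 : ℚ_[p]) 1) (fun _ => (1 : ℂ)) ((p : ℚ_[p]) ^ n * ξ)

theorem norm_p_zpow (n : ℤ) : ‖(p : ℚ_[p]) ^ n‖ = (p : ℝ) ^ (-n) := by
  rw [norm_zpow, Padic.norm_p, inv_zpow, zpow_neg]

theorem mem_ball_iff (n : ℤ) (ξ : ℚ_[p]) :
    (p : ℚ_[p]) ^ n * ξ ∈ Metric.closedBall (0 : ℚ_[p]) 1 ↔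
      ξ ∈ Metric.closedBall (0 : ℚ_[p]) ((p : ℝ) ^ n) := by
  have h3 : (0 : ℝ) < (p : ℝ) ^ n := by
    have : (0 : ℝ) < p := by exact_mod_cast (Fact.out : p.Prime).pos
    positivity
  rw [mem_closedBall_zero_iff, mem_closedBall_zero_iff, norm_mul, norm_p_zpow, zpow_neg,
    inv_mul_le_iff₀ h3, mul_one]

theorem haar_closedBall_zero : haar p (Metric.closedBall 0 1) = 1 :=
  Measure.addHaarMeasure_self

/-- A ball of radius `p ^ (n + 1)` is the disjoint union of `p` translates of a ball of radius
`p ^ n`. -/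
theorem closedBall_succ (n : ℤ) :
    Metric.closedBall (0 : ℚ_[p]) ((p : ℝ) ^ (n + 1)) =
      ⋃ i ∈ Finset.range p,
        (fun x => -((i : ℚ_[p]) * (p : ℚ_[p]) ^ (-(n + 1))) + x) ⁻¹'
          Metric.closedBall (0 : ℚ_[p]) ((p : ℝ) ^ n) := by
  have hp := (Fact.out : p.Prime)
  have hp0 : (p : ℚ_[p]) ≠ 0 := by exact_mod_cast hp.ne_zero
  have hpR : (0 : ℝ) < p := by exact_mod_cast hp.pos
  have hp1 : (1 : ℝ) ≤ p := by exact_mod_cast hp.one_lt.le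
  ext ξ
  simp only [Set.mem_iUnion, Finset.mem_range, Set.mem_preimage, exists_prop]
  constructor
  · intro h
    have hx := (mem_ball_iff p (n + 1) ξ).2 h
    rw [mem_closedBall_zero_iff] at hx
    let x : ℤ_[p] := ⟨_, hx⟩
    refine ⟨x.zmodRepr, x.zmodRepr_lt_p, ?_⟩
    have h1 : ‖x - x.zmodRepr‖ ≤ (p : ℝ) ^ (-(1 : ℕ) : ℤ) := by
      rw [PadicInt.norm_le_pow_iff_mem_span_pow, pow_one, ← PadicInt.maximalIdeal_eq_span_p]
      exact x.sub_zmodRepr_mem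
    have h2 : -((x.zmodRepr : ℚ_[p]) * (p : ℚ_[p]) ^ (-(n + 1))) + ξ
        = (p : ℚ_[p]) ^ (-(n + 1)) * ((x - x.zmodRepr : ℤ_[p]) : ℚ_[p]) := by
      have : ((x : ℤ_[p]) : ℚ_[p]) = (p : ℚ_[p]) ^ (n + 1) * ξ := rfl
      push_cast
      rw [this, mul_sub, ← mul_assoc, ← zpow_add₀ hp0]
      simp; ring
    rw [h2, mem_closedBall_zero_iff, norm_mul, norm_p_zpow, ← PadicInt.norm_def, neg_neg]
    calc _ ≤ (p : ℝ) ^ (n + 1) * (p : ℝ) ^ (-(1 : ℕ) : ℤ) := by gcongr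
      _ = (p : ℝ) ^ n := by rw [← zpow_add₀ hpR.ne']; simp
  · rintro ⟨i, -, hi⟩
    rw [mem_closedBall_zero_iff] at hi ⊢
    have : ξ = (i : ℚ_[p]) * (p : ℚ_[p]) ^ (-(n + 1))
        + (-((i : ℚ_[p]) * (p : ℚ_[p]) ^ (-(n + 1))) + ξ) := by ring
    rw [this]
    refine (Padic.nonarchimedean _ _).trans (max_le ?_ (hi.trans ?_))
    · rw [norm_mul, norm_p_zpow, neg_neg]
      have : ‖(i : ℚ_[p])‖ ≤ 1 := by simpa using Padic.norm_int_le_one (p := p) i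
      calc _ ≤ 1 * (p : ℝ) ^ (n + 1) := by gcongr
        _ = _ := one_mul _
    · exact zpow_le_zpow_right₀ hp1 (by lia)

theorem haar_closedBall_succ (n : ℤ) :
    haar p (Metric.closedBall 0 ((p : ℝ) ^ (n + 1))) =
      p * haar p (Metric.closedBall 0 ((p : ℝ) ^ n)) := by
  have hp := (Fact.out : p.Prime)
  have hp0 : (p : ℚ_[p]) ≠ 0 := by exact_mod_cast hp.ne_zero
  have hpR : (0 : ℝ) < p := by exact_mod_cast hp.pos
  rw [closedBall_succ, measure_biUnion_finset]
  · simp_rw [measure_preimage_add]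
    simp
  · intro i hi j hj hij
    rw [Function.onFun, Set.disjoint_left]
    intro ξ h1 h2
    simp only [Set.mem_preimage, mem_closedBall_zero_iff] at h1 h2
    simp only [Finset.coe_range, Set.mem_Iio] at hi hj
    have h3 : ‖((i : ℚ_[p]) - j) * (p : ℚ_[p]) ^ (-(n + 1))‖ ≤ (p : ℝ) ^ n := by
      have : ((i : ℚ_[p]) - j) * (p : ℚ_[p]) ^ (-(n + 1))
        = (-((j : ℚ_[p]) * (p : ℚ_[p]) ^ (-(n + 1))) + ξ)
          + -(-((i : ℚ_[p]) * (p : ℚ_[p]) ^ (-(n + 1))) + ξ) := by ring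
      rw [this]
      refine (Padic.nonarchimedean _ _).trans (max_le h2 ?_)
      rw [norm_neg]; exact h1
    rw [norm_mul, norm_p_zpow, neg_neg, zpow_add₀ hpR.ne', zpow_one] at h3
    have h4 : ‖(((i : ℤ) - j : ℤ) : ℚ_[p])‖ < 1 := by
      push_cast
      have h5 : (0 : ℝ) < (p : ℝ) ^ n := by positivity
      have hp1 : (1 : ℝ) < p := by exact_mod_cast hp.one_lt
      by_contra hc
      have : 1 ≤ ‖(i : ℚ_[p]) - j‖ := not_lt.1 hc
      nlinarith [mul_le_mul_of_nonneg_right this (by positivity : 0 ≤ (p : ℝ) ^ n * p)]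
    rw [Padic.norm_intCast_lt_one_iff] at h4
    obtain ⟨c, hc⟩ := h4
    apply hij
    have : c = 0 := by
      have a1 : (p : ℤ) * c < p := by rw [← hc]; lia
      have a2 : -(p : ℤ) < p * c := by rw [← hc]; lia
      have hpz : (0 : ℤ) < p := by exact_mod_cast hp.pos
      have : c < 1 := by nlinarith
      have : -1 < c := by nlinarith
      lia
    rw [this] at hc; lia
  · intro i _
    exact (measurable_const_add _) Metric.isClosed_closedBall.measurableSet

theorem haar_closedBall (n : ℤ) :
    haar p (Metric.closedBall 0 ((p : ℝ) ^ n)) = ENNReal.ofReal ((p : ℝ) ^ n) := by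
  have hp := (Fact.out : p.Prime)
  have hpR : (0 : ℝ) < p := by exact_mod_cast hp.pos
  induction n using Int.induction_on with
  | zero => simp [haar_closedBall_zero]
  | succ n ih =>
    rw [haar_closedBall_succ, ih, zpow_add₀ hpR.ne', zpow_one, mul_comm (_ ^ _),
      ENNReal.ofReal_mul hpR.le, ENNReal.ofReal_natCast]
  | pred n ih =>
    have := haar_closedBall_succ p (-(n : ℤ) - 1)
    rw [sub_add_cancel, ih] at this
    have h2 : (p : ℝ) ^ (-(n : ℤ)) = p * (p : ℝ) ^ (-(n : ℤ) - 1) := by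
      rw [zpow_sub₀ hpR.ne', zpow_one]; field_simp
    rw [h2, ENNReal.ofReal_mul hpR.le, ENNReal.ofReal_natCast] at this
    exact ((ENNReal.mul_right_inj (by simpa using hp.ne_zero) (by simp)).1 this).symm

theorem wavelet_eq (n : ℤ) :
    wavelet p n = Set.indicator (Metric.closedBall (0 : ℚ_[p]) ((p : ℝ) ^ n))
      (fun ξ => (p : ℂ) ^ (-(n : ℂ) / 2) * stdChar p ((p : ℚ_[p]) ^ (n - 1) * ξ)) := by
  classical
  ext ξ
  simp only [wavelet, Set.indicator_apply, mem_ball_iff]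
  split_ifs <;> simp

theorem norm_wavelet (n : ℤ) (ξ : ℚ_[p]) :
    ‖wavelet p n ξ‖ = Set.indicator (Metric.closedBall (0 : ℚ_[p]) ((p : ℝ) ^ n))
      (fun _ => (p : ℝ) ^ (-(n : ℝ) / 2)) ξ := by
  classical
  have hpR : (0 : ℝ) < p := by exact_mod_cast (Fact.out : p.Prime).pos
  rw [wavelet_eq]
  simp only [Set.indicator_apply]
  split_ifs
  · rw [norm_mul, norm_stdChar, mul_one]
    have : (-(n : ℂ) / 2) = ((-(n : ℝ) / 2 : ℝ) : ℂ) := by push_cast; rfl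
    rw [this, ← Complex.ofReal_natCast, Complex.norm_cpow_eq_rpow_re_of_pos hpR, Complex.ofReal_re]
  · simp

theorem memLp_wavelet (n : ℤ) : MemLp (wavelet p n) 2 (haar p) := by
  have hc : Continuous (fun ξ : ℚ_[p] =>
      (p : ℂ) ^ (-(n : ℂ) / 2) * stdChar p ((p : ℚ_[p]) ^ (n - 1) * ξ)) :=
    continuous_const.mul ((continuous_stdChar p).comp (continuous_const.mul continuous_id))
  have hm : MeasurableSet (Metric.closedBall (0 : ℚ_[p]) ((p : ℝ) ^ n)) :=
    Metric.isClosed_closedBall.measurableSet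
  rw [wavelet_eq, memLp_indicator_iff_restrict hm]
  have : IsFiniteMeasure ((haar p).restrict (Metric.closedBall (0 : ℚ_[p]) ((p : ℝ) ^ n))) :=
    ⟨by rw [Measure.restrict_apply_univ, haar_closedBall]; exact ENNReal.ofReal_lt_top⟩
  refine MemLp.of_bound hc.aestronglyMeasurable ‖(p : ℂ) ^ (-(n : ℂ) / 2)‖
    (Filter.Eventually.of_forall fun ξ => ?_)
  rw [norm_mul, norm_stdChar, mul_one]

/-- The wavelet `ψ_{n,0,1}` as an element of `L²(ℚ_p)`. -/
noncomputable def waveletL2 (n : ℤ) : Lp ℂ 2 (haar p) := (memLp_wavelet p n).toLp _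

theorem integral_wavelet_mul_of_lt {m n : ℤ} (h : m < n) :
    ∫ ξ, (starRingEnd ℂ) (wavelet p m ξ) * wavelet p n ξ ∂(haar p) = 0 := by
  classical
  have hp0 : (p : ℚ_[p]) ≠ 0 := by exact_mod_cast (Fact.out : p.Prime).ne_zero
  have hp1 : (1 : ℝ) ≤ p := by exact_mod_cast (Fact.out : p.Prime).one_lt.le
  set t : ℚ_[p] := (p : ℚ_[p]) ^ (-m) with ht
  have hball : ∀ k : ℤ, m ≤ k → ∀ ξ : ℚ_[p],
      (ξ + t ∈ Metric.closedBall (0 : ℚ_[p]) ((p : ℝ) ^ k) ↔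
        ξ ∈ Metric.closedBall (0 : ℚ_[p]) ((p : ℝ) ^ k)) := by
    intro k hk ξ
    have h1 : ‖t‖ ≤ (p : ℝ) ^ k := by
      rw [ht, norm_p_zpow, neg_neg]; exact zpow_le_zpow_right₀ hp1 hk
    simp only [mem_closedBall_zero_iff]
    constructor
    · intro h2
      have : ξ = (ξ + t) + -t := by ring
      rw [this]
      exact (Padic.nonarchimedean _ _).trans (max_le h2 (by rwa [norm_neg]))
    · intro h2
      exact (Padic.nonarchimedean _ _).trans (max_le h2 h1)
  have hm : ∀ ξ, wavelet p m (ξ + t) = stdChar p ((p : ℚ_[p])⁻¹) * wavelet p m ξ := by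
    intro ξ
    simp only [wavelet_eq, Set.indicator_apply, hball m le_rfl ξ]
    split_ifs
    · rw [mul_add, stdChar_add, ht, ← zpow_add₀ hp0]
      have : m - 1 + -m = -1 := by ring
      rw [this, zpow_neg_one]; ring
    · simp
  have hn : ∀ ξ, wavelet p n (ξ + t) = wavelet p n ξ := by
    intro ξ
    simp only [wavelet_eq, Set.indicator_apply, hball n h.le ξ]
    split_ifs
    · rw [mul_add, stdChar_add, ht, ← zpow_add₀ hp0, stdChar_eq_one p (_ ^ (n - 1 + -m)), mul_one]
      rw [norm_p_zpow]
      exact zpow_le_one_of_nonpos₀ hp1 (by lia)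
    · rfl
  have key := integral_add_right_eq_self (μ := haar p)
    (fun ξ => (starRingEnd ℂ) (wavelet p m ξ) * wavelet p n ξ) t
  simp only [hm, hn, map_mul, mul_assoc] at key
  rw [integral_const_mul] at key
  have hne : (starRingEnd ℂ) (stdChar p ((p : ℚ_[p])⁻¹)) ≠ 1 := by
    intro h
    apply stdChar_inv_p_ne_one p
    simpa using congrArg (starRingEnd ℂ) h
  by_contra hI
  exact hne (mul_right_cancel₀ hI (key.trans (one_mul _).symm))

theorem inner_waveletL2 (m n : ℤ) :
    inner ℂ (waveletL2 p m) (waveletL2 p n) =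
      ∫ ξ, (starRingEnd ℂ) (wavelet p m ξ) * wavelet p n ξ ∂(haar p) := by
  rw [L2.inner_def]
  refine integral_congr_ae ?_
  filter_upwards [(memLp_wavelet p m).coeFn_toLp, (memLp_wavelet p n).coeFn_toLp] with ξ h1 h2
  rw [waveletL2, waveletL2, h1, h2, RCLike.inner_apply, mul_comm]

theorem orthonormal_waveletL2 : Orthonormal ℂ (waveletL2 p) := by
  classical
  have hpR : (0 : ℝ) < p := by exact_mod_cast (Fact.out : p.Prime).pos
  refine ⟨fun n => ?_, fun m n hmn => ?_⟩
  · have h1 : inner ℂ (waveletL2 p n) (waveletL2 p n) = 1 := by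
      rw [inner_waveletL2]
      have : ∀ ξ, (starRingEnd ℂ) (wavelet p n ξ) * wavelet p n ξ
          = Set.indicator (Metric.closedBall (0 : ℚ_[p]) ((p : ℝ) ^ n))
            (fun _ => (((p : ℝ) ^ (-n) : ℝ) : ℂ)) ξ := by
        intro ξ
        rw [← Complex.normSq_eq_conj_mul_self, Complex.normSq_eq_norm_sq, norm_wavelet]
        simp only [Set.indicator_apply]
        split_ifs
        · rw [← Real.rpow_natCast, ← Real.rpow_mul hpR.le, ← Real.rpow_intCast]
          congr 2; push_cast; ring
        · simp
      simp_rw [this]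
      rw [integral_indicator Metric.isClosed_closedBall.measurableSet, setIntegral_const,
        measureReal_def, haar_closedBall, ENNReal.toReal_ofReal (by positivity),
        Complex.real_smul, ← Complex.ofReal_mul, ← zpow_add₀ hpR.ne']
      simp
    have h2 := inner_self_eq_norm_sq_to_K (𝕜 := ℂ) (waveletL2 p n)
    rw [h1] at h2
    have h3 : ‖waveletL2 p n‖ ^ 2 = 1 := Complex.ofReal_injective (by simpa using h2.symm)
    exact (pow_eq_one_iff_of_nonneg (norm_nonneg _) two_ne_zero).1 h3
  · rcases lt_or_gt_of_ne hmn with h | h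
    · rw [inner_waveletL2, integral_wavelet_mul_of_lt p h]
    · rw [← inner_conj_symm, inner_waveletL2, integral_wavelet_mul_of_lt p h, map_zero]

end Wavelets

/-! ### The space `H_-` and the raising and lowering operators -/

section HMinus
variable (p : ℕ) [Fact p.Prime]

/-- The closed subspace `H_-` of `L²(ℚ_p)` spanned by the wavelets `|m⟩ = ψ_{1-m,0,1}`, `m ≥ 0`. -/
noncomputable abbrev HMinus : Submodule ℂ (Lp ℂ 2 (haar p)) :=
  (Submodule.span ℂ (Set.range fun m : ℕ => waveletL2 p (1 - m))).topologicalClosure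

/-- The vector `|m⟩ = ψ_{1-m,0,1}` of `H_-`. -/
noncomputable def ket (m : ℕ) : HMinus p :=
  ⟨waveletL2 p (1 - m), Submodule.le_topologicalClosure _ (Submodule.subset_span ⟨m, rfl⟩)⟩

theorem orthonormal_ket : Orthonormal ℂ (ket p) := by
  have h : Orthonormal ℂ (fun m : ℕ => waveletL2 p (1 - m)) :=
    (orthonormal_waveletL2 p).comp (fun m : ℕ => (1 - m : ℤ)) (fun a b h => by simpa using h)
  exact ⟨fun m => h.1 m, fun m n hmn => h.2 hmn⟩

theorem span_ket_dense :
    ⊤ ≤ (Submodule.span ℂ (Set.range (ket p))).topologicalClosure := by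
  intro x _
  have hx := x.2
  rw [← SetLike.mem_coe, Submodule.topologicalClosure_coe] at hx ⊢
  rw [closure_subtype]
  convert hx using 2
  have : (fun m : ℕ => waveletL2 p (1 - m)) = (HMinus p).subtype ∘ ket p := rfl
  rw [this, Set.range_comp, Submodule.span_image]
  rfl

/-- The orthonormal basis `|m⟩`, `m ≥ 0`, of `H_-`. -/
noncomputable def ketBasis : HilbertBasis ℕ ℂ (HMinus p) :=
  HilbertBasis.mk (orthonormal_ket p) (span_ket_dense p)

theorem ketBasis_apply (m : ℕ) : ketBasis p m = ket p m := by
  rw [ketBasis, HilbertBasis.coe_mk]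

/-- Two bounded operators on `H_-` that agree on the wavelets are equal. -/
theorem clm_ext {S T : HMinus p →L[ℂ] HMinus p} (h : ∀ m, S (ket p m) = T (ket p m)) : S = T := by
  refine ContinuousLinearMap.ext_on (s := Set.range (ket p)) ?_ ?_
  · intro x
    have := span_ket_dense p (Submodule.mem_top (x := x))
    rwa [← SetLike.mem_coe, Submodule.topologicalClosure_coe] at this
  · rintro _ ⟨m, rfl⟩; exact h m

theorem orthonormal_ket_succ : Orthonormal ℂ (fun m : ℕ => ket p (m + 1)) :=
  (orthonormal_ket p).comp _ (add_left_injective 1)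

/-- The operator `a_-` on `H_-`: it lowers the scale of the wavelets by one,
`a_- ψ_{n,0,1} = ψ_{n-1,0,1}`, that is, `a_-|m⟩ = |m + 1⟩`. -/
noncomputable def aMinus : HMinus p →L[ℂ] HMinus p :=
  ((orthonormal_ket_succ p).orthogonalFamily.linearIsometry.comp
    (ketBasis p).repr.toLinearIsometry).toContinuousLinearMap

theorem aMinus_ket (m : ℕ) : aMinus p (ket p m) = ket p (m + 1) := by
  classical
  have h : (ketBasis p).repr (ket p m) = lp.single 2 m (1 : ℂ) := by
    rw [← ketBasis_apply, HilbertBasis.repr_self]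
  simp [aMinus, h, OrthogonalFamily.linearIsometry_apply_single, LinearIsometry.toSpanSingleton_apply]

/-- The operator `a_+` on `H_-`: it raises the scale of the wavelets by one,
`a_+ ψ_{n,0,1} = ψ_{n+1,0,1}`, and annihilates the ground state `|0⟩ = ψ_{1,0,1}`; that is,
`a_+|0⟩ = 0` and `a_+|m + 1⟩ = |m⟩` (see `aPlus_ket_zero` and `aPlus_ket_succ`). -/
noncomputable def aPlus : HMinus p →L[ℂ] HMinus p := ContinuousLinearMap.adjoint (aMinus p)

theorem inner_ket (m n : ℕ) : inner ℂ (ket p m) (ket p n) = if m = n then 1 else 0 := by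
  exact orthonormal_iff_ite.1 (orthonormal_ket p) m n

theorem ext_inner_ket {x y : HMinus p} (h : ∀ m, inner ℂ (ket p m) x = inner ℂ (ket p m) y) :
    x = y := by
  apply (ketBasis p).repr.injective
  ext m
  rw [HilbertBasis.repr_apply_apply, HilbertBasis.repr_apply_apply, ketBasis_apply, h]

theorem aPlus_ket_zero : aPlus p (ket p 0) = 0 := by
  refine ext_inner_ket p fun m => ?_
  rw [aPlus, ContinuousLinearMap.adjoint_inner_right, aMinus_ket, inner_ket, inner_zero_right,
    if_neg (Nat.succ_ne_zero m)]

theorem aPlus_ket_succ (m : ℕ) : aPlus p (ket p (m + 1)) = ket p m := by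
  refine ext_inner_ket p fun n => ?_
  rw [aPlus, ContinuousLinearMap.adjoint_inner_right, aMinus_ket, inner_ket, inner_ket]
  simp

end HMinus

/-! ### Traces and tensor products of operators -/

/-- `T` is of trace class with trace `t`: for every orthonormal basis `(b_i)` the series
`∑ ⟨b_i, T b_i⟩` converges unconditionally with sum `t`. -/
def HasTrace {E : Type} [NormedAddCommGroup E] [InnerProductSpace ℂ E] (T : E →L[ℂ] E) (t : ℂ) :
    Prop :=
  ∀ (ι : Type) (b : HilbertBasis ι ℂ E), HasSum (fun i => inner ℂ (b i) (T (b i))) t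

section HilbertTensor
open scoped TensorProduct

/-- The Hilbert space tensor product of `E` and `F`. -/
abbrev HilbertTensor (E F : Type) [NormedAddCommGroup E] [InnerProductSpace ℂ E]
    [NormedAddCommGroup F] [InnerProductSpace ℂ F] : Type :=
  UniformSpace.Completion (E ⊗[ℂ] F)

/-- The bounded operator `A ⊗ B` on the Hilbert space tensor product, with
`(A ⊗ B)(x ⊗ y) = A x ⊗ B y`. -/
noncomputable def tensorOp {E F : Type} [NormedAddCommGroup E] [InnerProductSpace ℂ E]
    [NormedAddCommGroup F] [InnerProductSpace ℂ F] (A : E →L[ℂ] E) (B : F →L[ℂ] F) :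
    HilbertTensor E F →L[ℂ] HilbertTensor E F :=
  (TensorProduct.mapL A B).completion

end HilbertTensor

/-! ### The twisted Vladimirov derivative -/

section Vladimirov
variable (p : ℕ) [Fact p.Prime]

/-- `w` is the value at `z` of the analytic continuation of `f` from `U`: there is a closed
countable set `S` of singularities not containing `z` and a function `F`, holomorphic on `ℂ ∖ S`,
that agrees with `f` on `U` and takes the value `w` at `z`. (As `ℂ ∖ S` is connected, `w` is unique
when `U` is open and nonempty.) -/
def IsContinuationValue (f : ℂ → ℂ) (U : Set ℂ) (z w : ℂ) : Prop :=
  ∃ (S : Set ℂ) (F : ℂ → ℂ), S.Countable ∧ IsClosed S ∧ Disjoint U S ∧ z ∉ S ∧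
    DifferentiableOn ℂ F Sᶜ ∧ Set.EqOn F f U ∧ F z = w

open Classical in
/-- The value at `z` of the analytic continuation of `f` from `U` (and `0` if there is none). -/
noncomputable def continuation (f : ℂ → ℂ) (U : Set ℂ) (z : ℂ) : ℂ :=
  if h : ∃ w, IsContinuationValue f U z w then h.choose else 0

/-- The extended function `𝔞 : p^ℤ → ℂ` with `𝔞(p) = a`, as a function of the exponent `n`:
`𝔞(p^n) = a ^ n` if `a ≠ 0`, and `𝔞 = 0` if `a = 0`. -/
noncomputable def extChar (a : ℂ) (n : ℤ) : ℂ := if a = 0 then 0 else a ^ n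

/-- The gamma integral `∫ e^{2πiξ} |ξ|_p^{s-1} 𝔞(|ξ|_p⁻¹) dξ`, as the limit of the integrals over
the balls `|ξ|_p ≤ p ^ M`. Here `|ξ|_p⁻¹ = p ^ v(ξ)` with the `p`-adic valuation `v`. -/
noncomputable def gammaIntegral (a s : ℂ) : ℂ :=
  Filter.limUnder Filter.atTop fun M : ℕ =>
    ∫ ξ in Metric.closedBall (0 : ℚ_[p]) ((p : ℝ) ^ M),
      stdChar p ξ * ((‖ξ‖ : ℝ) : ℂ) ^ (s - 1) * extChar a ξ.valuation ∂(haar p)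

/-- The gamma function `Γ_𝔞(s)`: the analytic continuation of the gamma integral from its region
of convergence `|a| < p ^ Re s`. -/
noncomputable def twistedGamma (a s : ℂ) : ℂ :=
  continuation (gammaIntegral p a) {s | ‖a‖ < (p : ℝ) ^ s.re} s

/-- The integral that defines `D_𝔞^α g (ξ)`, namely
`Γ_𝔞(-α)⁻¹ ∫ (g(ξ') - g(ξ)) |ξ' - ξ|_p^{-(α+1)} 𝔞(|ξ' - ξ|_p⁻¹) dξ'`. -/
noncomputable def vladimirovIntegral (a α : ℂ) (g : ℚ_[p] → ℂ) (ξ : ℚ_[p]) : ℂ :=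
  (twistedGamma p a (-α))⁻¹ *
    ∫ η, (g η - g ξ) / ((‖η - ξ‖ : ℝ) : ℂ) ^ (α + 1) * extChar a (η - ξ).valuation ∂(haar p)

open Classical in
/-- The generalised Vladimirov derivative `D_𝔞^α g`: for each `ξ` the analytic continuation, as a
function of `α`, of the integral above from the half-plane `|a| p ^ Re α > 1` in which it converges
for locally constant `g` of compact support. If `a = 0`, then `D_𝔞^α` is the identity. -/
noncomputable def vladimirov (a α : ℂ) (g : ℚ_[p] → ℂ) (ξ : ℚ_[p]) : ℂ :=
  if a = 0 then g ξ
  else continuation (fun β => vladimirovIntegral p a β g ξ) {β | 1 < ‖a‖ * (p : ℝ) ^ β.re} α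

/-- The bounded operator `T` on `H_-` is the restriction of `D_𝔞^α` to `H_-`: it agrees with
`D_𝔞^α` on the wavelets that span `H_-`. By `clm_ext` there is at most one such `T`. -/
def IsVladimirovOn (a α : ℂ) (T : HMinus p →L[ℂ] HMinus p) : Prop :=
  ∀ m : ℕ, ((T (ket p m) : Lp ℂ 2 (haar p)) : ℚ_[p] → ℂ) =ᵐ[haar p]
    vladimirov p a α (wavelet p (1 - m))

open Classical in
/-- The operator `D_𝔞^α` on `H_-` (and `0` if it is not bounded there). -/
noncomputable def vladimirovOp (a α : ℂ) : HMinus p →L[ℂ] HMinus p :=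
  if h : ∃ T, IsVladimirovOn p a α T then h.choose else 0

end Vladimirov

/-! ### Hecke eigenforms -/

section Modular
open UpperHalfPlane CongruenceSubgroup
open scoped MatrixGroups

/-- The cusp form `f` of weight `k` on `Γ₁(N)` has character `χ`:
`f((az+b)/(cz+d)) = χ(d) (cz+d)^k f(z)` for all `(a b; c d) ∈ Γ₀(N)`. -/
def HasCharacter {N : ℕ} {k : ℤ} (χ : DirichletCharacter ℂ N)
    (f : CuspForm (Gamma1 N : Subgroup (GL (Fin 2) ℝ)) k) : Prop :=
  ∀ γ ∈ Gamma0 N, ∀ z : ℍ,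
    f (γ • z) = χ ((γ 1 1 : ℤ) : ZMod N) * ((γ 1 0 : ℂ) * z + (γ 1 1 : ℂ)) ^ k * f z

/-- The Hecke operator `T(q)`, `q` prime, on forms of weight `k` and character `χ`:
`(T(q) f)(z) = χ(q) q^{k-1} f(qz) + q⁻¹ ∑_{0 ≤ b < q} f((z+b)/q)`. -/
noncomputable def heckeT {N : ℕ} (χ : DirichletCharacter ℂ N) (k : ℤ) (q : ℕ) (f : ℍ → ℂ)
    (z : ℍ) : ℂ :=
  χ (q : ZMod N) * (q : ℂ) ^ (k - 1) * f (ofComplex (q * z)) +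
    (q : ℂ)⁻¹ * ∑ b ∈ Finset.range q, f (ofComplex ((z + b) / q))

/-- `f` is an eigenvector of all Hecke operators `T(q)`, `q` prime. -/
def IsHeckeEigenform {N : ℕ} {k : ℤ} (χ : DirichletCharacter ℂ N)
    (f : CuspForm (Gamma1 N : Subgroup (GL (Fin 2) ℝ)) k) : Prop :=
  ∀ q : ℕ, q.Prime → ∃ c : ℂ, ∀ z : ℍ, heckeT χ k q f z = c * f z

/-- The coefficient `a(n)` of the expansion `f(z) = ∑ a(n) e^{2πinz}`. -/
noncomputable def fourierCoeff {N : ℕ} {k : ℤ}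
    (f : CuspForm (Gamma1 N : Subgroup (GL (Fin 2) ℝ)) k) (n : ℕ) : ℂ :=
  (qExpansion 1 f).coeff n

/-- The local factor `L_{(p)}(s, f) = (1 - a(p) p^{-s} + χ(p) p^{k-1} p^{-2s})⁻¹`. -/
noncomputable def localL {N : ℕ} {k : ℤ} (χ : DirichletCharacter ℂ N)
    (f : CuspForm (Gamma1 N : Subgroup (GL (Fin 2) ℝ)) k) (p : ℕ) (s : ℂ) : ℂ :=
  (1 - fourierCoeff f p * (p : ℂ) ^ (-s) +
    χ (p : ZMod N) * (p : ℂ) ^ (k - 1) * (p : ℂ) ^ (-2 * s))⁻¹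

end Modular
end PadicHecke

/-! Everything is diagonal on the wavelets. Translating the variable turns the integral that defines
`D^α` at a wavelet `ψ_n` into a sum over spheres on which the weight is constant, equal to `t ^ k`
on `|u| = p ^ k` with `p t = (a p^α)⁻¹`. Only integrals of an additive character over balls occur,
and these are `0` or the volume. The result is a geometric series with numerator `1 - t`. The gamma
integral yields the same numerator, and the quotient is the eigenvalue `(a p^α)^(1-n)`
(`vladimirovIntegral_wavelet`). It is entire in `α`, so it is also the value of the continuation
(`vladimirov_wavelet`, `continuation_eq`).

With `c_i = a_i p^(-s)` this reads `D_i|m⟩ = c_i^m|m⟩`. Hence `a_+^j D_i a_-^j = c_i^j D_i`, and the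
operator of the theorem is `∑ c₁^j c₂^(ℓ-j)` times `D₁ ⊗ D₂`. The latter is diagonal on the product
basis with absolutely summable eigenvalues `c₁^m c₂^n`. Its trace, in any orthonormal basis by
Parseval and Fubini (`hasTrace_of_hasSum_rankOne`), is `1/((1-c₁)(1-c₂))`, the local factor.

On the modular side, comparing Fourier coefficients in `T(p) f = c f` gives a two-term recursion for
`a(p^ℓ)`, which the complete homogeneous sums in `a₁, a₂` also satisfy (`fourierCoeff_prime_pow`).
With Hecke's bound `a(n) = O(n^(k/2))` this forces `|a_i| ≤ p^(k/2)`, whence the explicit half-plane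
for `s`. -/

namespace PadicHecke
-- Uniqueness of analytic continuation
section Continuation

/-- Removing both countable closed singular sets leaves the plane connected, since its real
dimension exceeds one; the identity theorem, started at a point of `U`, then applies to the two
extensions. -/
theorem IsContinuationValue.eq_of_differentiableOn {f G : ℂ → ℂ} {U S : Set ℂ} {z w : ℂ}
    (h : IsContinuationValue f U z w) (hU : IsOpen U) (hne : U.Nonempty) (hS : S.Countable)
    (hSc : IsClosed S) (hUS : Disjoint U S) (hz : z ∉ S) (hG : DifferentiableOn ℂ G Sᶜ)
    (hGf : Set.EqOn G f U) : w = G z := by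
  obtain ⟨S', F, hS', hSc', hUS', hz', hF, hFf, rfl⟩ := h
  obtain ⟨u, hu⟩ := hne
  have hcount : (S ∪ S').Countable := hS.union hS'
  have hopen : IsOpen (S ∪ S')ᶜ := (hSc.union hSc').isOpen_compl
  have hconn := (hcount.isConnected_compl_of_one_lt_rank (E := ℂ)
    (by rw [Complex.rank_real_complex]; norm_num)).isPreconnected
  have hF' : AnalyticOnNhd ℂ F (S ∪ S')ᶜ :=
    (hF.mono (Set.compl_subset_compl.2 Set.subset_union_right)).analyticOnNhd hopen
  have hG' : AnalyticOnNhd ℂ G (S ∪ S')ᶜ :=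
    (hG.mono (Set.compl_subset_compl.2 Set.subset_union_left)).analyticOnNhd hopen
  have hu' : u ∈ (S ∪ S')ᶜ := fun h => h.elim (hUS.notMem_of_mem_left hu)
    (hUS'.notMem_of_mem_left hu)
  refine hF'.eqOn_of_preconnected_of_eventuallyEq hG' hconn hu' ?_ fun h => h.elim hz hz'
  filter_upwards [hU.mem_nhds hu] with x hx
  rw [hFf hx, hGf hx]

/-- `continuation` is defined by choice; this reduces its evaluation to exhibiting one closed
formula `G`. -/
theorem continuation_eq {f G : ℂ → ℂ} {U S : Set ℂ} {z : ℂ} (hU : IsOpen U) (hne : U.Nonempty)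
    (hS : S.Countable) (hSc : IsClosed S) (hUS : Disjoint U S) (hz : z ∉ S)
    (hG : DifferentiableOn ℂ G Sᶜ) (hGf : Set.EqOn G f U) : continuation f U z = G z := by
  have h : ∃ w, IsContinuationValue f U z w := ⟨G z, S, G, hS, hSc, hUS, hz, hG, hGf, rfl⟩
  rw [continuation, dif_pos h]
  exact h.choose_spec.eq_of_differentiableOn hU hne hS hSc hUS hz hG hGf

end Continuation
-- Hecke recursion and growth of the coefficients
section HeckeRecursion
open UpperHalfPlane CongruenceSubgroup
open scoped MatrixGroups

variable {N : ℕ} {k : ℤ} (f : CuspForm (Gamma1 N : Subgroup (GL (Fin 2) ℝ)) k)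

theorem one_mem_strictPeriods_Gamma1 (N : ℕ) :
    (1 : ℝ) ∈ (Gamma1 N : Subgroup (GL (Fin 2) ℝ)).strictPeriods := by
  simp

theorem hasSum_fourierCoeff (z : ℍ) :
    HasSum (fun n => fourierCoeff f n * Complex.exp (2 * Real.pi * Complex.I * z) ^ n) (f z) := by
  have : Fact (IsCusp OnePoint.infty (Gamma1 N : Subgroup (GL (Fin 2) ℝ))) :=
    ⟨Subgroup.isCusp_of_mem_strictPeriods one_pos (one_mem_strictPeriods_Gamma1 N)⟩
  have := ModularForm.hasSum_qExpansion (f := f) one_pos (one_mem_strictPeriods_Gamma1 N) z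
  simpa [fourierCoeff, Function.Periodic.qParam] using this

theorem hasSum_fourierCoeff_ofComplex {w : ℂ} (hw : 0 < w.im) :
    HasSum (fun n => fourierCoeff f n * Complex.exp (2 * Real.pi * Complex.I * w) ^ n)
      (f (ofComplex w)) := by
  have := hasSum_fourierCoeff f (ofComplex w)
  rwa [ofComplex_apply_of_im_pos hw] at this ⊢

/-- The sum over the `q`-th roots of unity that extracts the multiples of `q`. -/
theorem sum_exp_shift_pow {q : ℕ} (hq : q ≠ 0) (z : ℂ) (n : ℕ) :
    ∑ b ∈ Finset.range q, Complex.exp (2 * Real.pi * Complex.I * ((z + b) / q)) ^ n =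
      if q ∣ n then q * Complex.exp (2 * Real.pi * Complex.I * z) ^ (n / q) else 0 := by
  have hq' : (q : ℂ) ≠ 0 := by exact_mod_cast hq
  set ζ := Complex.exp (2 * Real.pi * Complex.I / q) with hζ
  have hprim : IsPrimitiveRoot ζ q := Complex.isPrimitiveRoot_exp q hq
  have h1 : ∀ b : ℕ, Complex.exp (2 * Real.pi * Complex.I * ((z + b) / q)) ^ n =
      Complex.exp (2 * Real.pi * Complex.I * (z / q)) ^ n * (ζ ^ n) ^ b := by
    intro b
    rw [hζ, ← Complex.exp_nat_mul, ← Complex.exp_nat_mul, ← Complex.exp_nat_mul,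
      ← Complex.exp_nat_mul, ← Complex.exp_add]
    congr 1; field_simp
  simp_rw [h1, ← Finset.mul_sum]
  split_ifs with h
  · obtain ⟨m, rfl⟩ := h
    have : ζ ^ (q * m) = 1 := by rw [pow_mul, hprim.pow_eq_one, one_pow]
    rw [this, Nat.mul_div_cancel_left _ (Nat.pos_of_ne_zero hq), ← Complex.exp_nat_mul,
      ← Complex.exp_nat_mul]
    simp only [one_pow, Finset.sum_const, Finset.card_range, nsmul_eq_mul, mul_one]
    rw [mul_comm]
    congr 2; push_cast; field_simp
  · have hne : ζ ^ n ≠ 1 := fun h' => h ((hprim.pow_eq_one_iff_dvd n).1 h')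
    rw [geom_sum_eq hne, ← pow_mul, mul_comm n q, pow_mul, hprim.pow_eq_one]
    simp

/-- The term `f(qz)` contributes only exponents divisible by `q`, while averaging over the shifts
`(z+b)/q` keeps only the coefficients whose index is divisible by `q`. -/
theorem hasSum_heckeT (χ : DirichletCharacter ℂ N) {q : ℕ} (hq : q ≠ 0) (z : ℍ) :
    HasSum (fun m => (χ (q : ZMod N) * (q : ℂ) ^ (k - 1) *
        (if q ∣ m then fourierCoeff f (m / q) else 0) + fourierCoeff f (q * m)) *
        Complex.exp (2 * Real.pi * Complex.I * z) ^ m) (heckeT χ k q f z) := by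
  have hq' : (q : ℂ) ≠ 0 := by exact_mod_cast hq
  have hqR : (0 : ℝ) < q := by exact_mod_cast Nat.pos_of_ne_zero hq
  have hinj : Function.Injective fun m : ℕ => q * m :=
    fun a b h => Nat.eq_of_mul_eq_mul_left (Nat.pos_of_ne_zero hq) h
  set e := Complex.exp (2 * Real.pi * Complex.I * z) with he
  have h1 : HasSum (fun m => (if q ∣ m then fourierCoeff f (m / q) else 0) * e ^ m)
      (f (ofComplex (q * z))) := by
    -- Reindex along `m ↦ q m`; the terms off its range vanish.
    rw [← hinj.hasSum_iff]
    · have h := hasSum_fourierCoeff_ofComplex f (w := q * z)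
        (by simpa using mul_pos hqR z.im_pos)
      convert h using 2 with m
      simp only [Function.comp_apply, dvd_mul_right, if_true]
      rw [Nat.mul_div_cancel_left _ (Nat.pos_of_ne_zero hq), he, ← Complex.exp_nat_mul,
        ← Complex.exp_nat_mul]
      congr 2; push_cast; ring
    · intro m hm
      rw [if_neg, zero_mul]
      rintro ⟨c, rfl⟩; exact hm ⟨c, rfl⟩
  have h2 : HasSum (fun m => fourierCoeff f (q * m) * (q * e ^ m))
      (∑ b ∈ Finset.range q, f (ofComplex ((z + b) / q))) := by
    have h := hasSum_sum fun b (_ : b ∈ Finset.range q) =>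
      hasSum_fourierCoeff_ofComplex f (w := (z + b) / q) (by
        rw [Complex.div_natCast_im]
        simpa using div_pos z.im_pos hqR)
    simp_rw [← Finset.mul_sum, sum_exp_shift_pow hq] at h
    rw [← hinj.hasSum_iff] at h
    · convert h using 2 with m
      simp [Nat.mul_div_cancel_left _ (Nat.pos_of_ne_zero hq), he]
    · intro m hm
      rw [if_neg, mul_zero]
      rintro ⟨c, rfl⟩; exact hm ⟨c, rfl⟩
  rw [heckeT]
  refine ((h1.mul_left (χ (q : ZMod N) * (q : ℂ) ^ (k - 1))).add
    (h2.mul_left (q : ℂ)⁻¹)).congr_fun fun m => ?_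
  rw [add_mul, mul_left_comm _ (q : ℂ), inv_mul_cancel_left₀ hq', mul_assoc]

/-- Both sides are coefficient sequences of expansions of the one cusp form `c • f`, so uniqueness
of the expansion suffices; modularity of `T(q) f` need not be known in advance. -/
theorem fourierCoeff_of_heckeT_eq {χ : DirichletCharacter ℂ N} {q : ℕ} (hq : q ≠ 0) {c : ℂ}
    (h : ∀ z : ℍ, heckeT χ k q f z = c * f z) (m : ℕ) :
    c * fourierCoeff f m = χ (q : ZMod N) * (q : ℂ) ^ (k - 1) *
        (if q ∣ m then fourierCoeff f (m / q) else 0) + fourierCoeff f (q * m) := by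
  have hΓ := one_mem_strictPeriods_Gamma1 N
  rw [ModularFormClass.qExpansion_coeff_unique (f := c • f) one_pos hΓ
      (c := fun m => c * fourierCoeff f m) (fun τ => ?_) m,
    ← ModularFormClass.qExpansion_coeff_unique (f := c • f) one_pos hΓ
      (c := fun m => χ (q : ZMod N) * (q : ℂ) ^ (k - 1) *
        (if q ∣ m then fourierCoeff f (m / q) else 0) + fourierCoeff f (q * m)) (fun τ => ?_) m]
  · simpa [Function.Periodic.qParam, h] using hasSum_heckeT f χ hq τ
  · simpa [Function.Periodic.qParam, mul_assoc] using (hasSum_fourierCoeff f τ).mul_left c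

variable {f}

/-- The coefficient at `1` identifies the eigenvalue as `a(p)`; the coefficient at `p ^ (l + 1)` is
then the recursion. -/
theorem fourierCoeff_prime_pow_add_two {χ : DirichletCharacter ℂ N} (hf : IsHeckeEigenform χ f)
    (hf1 : fourierCoeff f 1 = 1) {p : ℕ} (hp : p.Prime) (l : ℕ) :
    fourierCoeff f (p ^ (l + 2)) = fourierCoeff f p * fourierCoeff f (p ^ (l + 1)) -
      χ (p : ZMod N) * (p : ℂ) ^ (k - 1) * fourierCoeff f (p ^ l) := by
  obtain ⟨c, hc⟩ := hf p hp
  have h1 := fourierCoeff_of_heckeT_eq f hp.ne_zero hc 1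
  have h2 := fourierCoeff_of_heckeT_eq f hp.ne_zero hc (p ^ (l + 1))
  rw [if_neg (by simpa using hp.ne_one), hf1] at h1
  rw [if_pos (dvd_pow_self p l.succ_ne_zero), pow_succ p l, Nat.mul_div_cancel _ hp.pos,
    ← pow_succ, ← pow_succ'] at h2
  simp only [mul_one, mul_zero, zero_add] at h1
  rw [h1] at h2
  rw [h2]; ring

theorem sum_pow_mul_pow_add_two {R : Type*} [CommRing R] (a b : R) (l : ℕ) :
    ∑ j ∈ Finset.range (l + 3), a ^ j * b ^ (l + 2 - j) =
      (a + b) * ∑ j ∈ Finset.range (l + 2), a ^ j * b ^ (l + 1 - j) -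
        a * b * ∑ j ∈ Finset.range (l + 1), a ^ j * b ^ (l - j) := by
  -- Splitting off the top power of `a` gives the one-step relation `h_{l+1} = b h_l + a^(l+1)`; two
  -- uses of it give the claim.
  have h : ∀ l : ℕ, ∑ j ∈ Finset.range (l + 2), a ^ j * b ^ (l + 1 - j) =
      b * ∑ j ∈ Finset.range (l + 1), a ^ j * b ^ (l - j) + a ^ (l + 1) := by
    intro l
    rw [Finset.sum_range_succ, Finset.mul_sum]
    congr 1
    · refine Finset.sum_congr rfl fun j hj => ?_
      rw [Nat.succ_sub (Finset.mem_range_succ_iff.1 hj), pow_succ]; ring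
    · simp
  rw [h (l + 1), h l]; ring

theorem fourierCoeff_prime_pow {χ : DirichletCharacter ℂ N} (hf : IsHeckeEigenform χ f)
    (hf1 : fourierCoeff f 1 = 1) {p : ℕ} (hp : p.Prime) {a₁ a₂ : ℂ}
    (hadd : a₁ + a₂ = fourierCoeff f p)
    (hmul : a₁ * a₂ = χ (p : ZMod N) * (p : ℂ) ^ (k - 1)) (l : ℕ) :
    fourierCoeff f (p ^ l) = ∑ j ∈ Finset.range (l + 1), a₁ ^ j * a₂ ^ (l - j) := by
  induction l using Nat.twoStepInduction with
  | zero => simpa using hf1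
  | one => simp [Finset.sum_range_succ, ← hadd, add_comm]
  | more l h1 h2 =>
    rw [fourierCoeff_prime_pow_add_two hf hf1 hp, h1, h2, ← hadd, ← hmul,
      ← sum_pow_mul_pow_add_two]

/-- If the complete homogeneous sums of `a` and `b` grow at most like `r ^ l`, then `|a| ≤ r`. -/
theorem norm_le_of_sum_pow_mul_pow_le {a b : ℂ} {r C : ℝ} (hr : 0 < r)
    (h : ∀ l : ℕ, ‖∑ j ∈ Finset.range (l + 1), a ^ j * b ^ (l - j)‖ ≤ C * r ^ l) : ‖a‖ ≤ r := by
  -- A difference of consecutive sums isolates a pure power of `a`, so the powers of `|a| / r` stay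
  -- bounded.
  have h1 : ∀ l : ℕ, a ^ (l + 1) = ∑ j ∈ Finset.range (l + 2), a ^ j * b ^ (l + 1 - j) -
      b * ∑ j ∈ Finset.range (l + 1), a ^ j * b ^ (l - j) := by
    intro l
    rw [Finset.sum_range_succ, Finset.mul_sum, Nat.sub_self, pow_zero, mul_one,
      eq_comm, sub_eq_iff_eq_add, add_comm (a ^ _), add_left_inj]
    refine Finset.sum_congr rfl fun j hj => ?_
    rw [Nat.succ_sub (Finset.mem_range_succ_iff.1 hj), pow_succ]; ring
  have h2 : ∀ l : ℕ, (‖a‖ / r) ^ (l + 1) ≤ C + ‖b‖ * C / r := by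
    intro l
    rw [div_pow, div_le_iff₀ (by positivity), ← norm_pow, h1]
    refine (norm_sub_le _ _).trans ?_
    rw [norm_mul]
    calc _ ≤ C * r ^ (l + 1) + ‖b‖ * (C * r ^ l) := by gcongr <;> exact h _
      _ = _ := by field_simp; ring
  by_contra hlt
  have h3 : 1 < ‖a‖ / r := (one_lt_div hr).2 (not_le.1 hlt)
  obtain ⟨n, hn⟩ := pow_unbounded_of_one_lt (C + ‖b‖ * C / r) h3
  exact absurd (h2 n) (not_le.2 (hn.trans (pow_lt_pow_right₀ h3 n.lt_succ_self)))

/-- Hecke's bound at the indices `p ^ l` controls the homogeneous sums by `(p^(k/2))^l`. The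
hypotheses are symmetric in the two roots, so the bound serves both. -/
theorem norm_le_of_eigenform [NeZero N] {χ : DirichletCharacter ℂ N} (hf : IsHeckeEigenform χ f)
    (hf1 : fourierCoeff f 1 = 1) {p : ℕ} (hp : p.Prime) {a₁ a₂ : ℂ}
    (hadd : a₁ + a₂ = fourierCoeff f p)
    (hmul : a₁ * a₂ = χ (p : ZMod N) * (p : ℂ) ^ (k - 1)) :
    ‖a₁‖ ≤ (p : ℝ) ^ ((k : ℝ) / 2) := by
  have hpR : (0 : ℝ) < p := by exact_mod_cast hp.pos
  have hO := CuspFormClass.qExpansion_isBigO f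
  rw [strictWidthInfty_Gamma1] at hO
  -- Over `ℕ` the asymptotic bound holds with one constant wherever the comparison function is
  -- nonzero, so it holds at every `p ^ l`.
  obtain ⟨C, -, hC⟩ := Asymptotics.bound_of_isBigO_nat_atTop hO
  refine norm_le_of_sum_pow_mul_pow_le (b := a₂) (C := C) (Real.rpow_pos_of_pos hpR _) fun l => ?_
  have hpl : (((p ^ l : ℕ) : ℝ)) ^ ((k : ℝ) / 2) = ((p : ℝ) ^ ((k : ℝ) / 2)) ^ l := by
    rw [Nat.cast_pow, ← Real.rpow_natCast_mul hpR.le, mul_comm, Real.rpow_mul_natCast hpR.le]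
  have hpos : (0 : ℝ) < ((p : ℝ) ^ ((k : ℝ) / 2)) ^ l := by positivity
  have h := hC (x := p ^ l) (by rw [hpl]; exact hpos.ne')
  rwa [hpl, Real.norm_of_nonneg hpos.le, ← fourierCoeff, fourierCoeff_prime_pow hf hf1 hp hadd hmul]
    at h

end HeckeRecursion
-- Integration over balls and spheres of `ℚ_p`
section Spheres
variable (p : ℕ) [Fact p.Prime]

theorem cast_prime_pos : (0 : ℝ) < p := by exact_mod_cast (Fact.out : p.Prime).pos

theorem one_lt_cast_prime : (1 : ℝ) < p := by exact_mod_cast (Fact.out : p.Prime).one_lt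

theorem sphere_zpow_eq_diff (n : ℤ) :
    Metric.sphere (0 : ℚ_[p]) ((p : ℝ) ^ n) =
      Metric.closedBall 0 ((p : ℝ) ^ n) \ Metric.closedBall 0 ((p : ℝ) ^ (n - 1)) := by
  ext ξ
  simp only [mem_sphere_zero_iff_norm, Set.mem_sdiff, mem_closedBall_zero_iff, not_le]
  constructor
  · rintro h
    rw [h]
    exact ⟨le_rfl, zpow_lt_zpow_right₀ (one_lt_cast_prime p) (by lia)⟩
  · rintro ⟨h1, h2⟩
    have h0 : ξ ≠ 0 := norm_pos_iff.1 ((zpow_pos (cast_prime_pos p) _).trans h2)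
    rw [Padic.norm_eq_zpow_neg_valuation h0] at h1 h2 ⊢
    rw [zpow_le_zpow_iff_right₀ (one_lt_cast_prime p)] at h1
    rw [zpow_lt_zpow_iff_right₀ (one_lt_cast_prime p)] at h2
    congr 1; lia

theorem closedBall_pred_subset (n : ℤ) :
    Metric.closedBall (0 : ℚ_[p]) ((p : ℝ) ^ (n - 1)) ⊆ Metric.closedBall 0 ((p : ℝ) ^ n) :=
  Metric.closedBall_subset_closedBall (zpow_le_zpow_right₀ (one_lt_cast_prime p).le (by lia))

theorem measureReal_closedBall (n : ℤ) :
    (haar p).real (Metric.closedBall 0 ((p : ℝ) ^ n)) = (p : ℝ) ^ n := by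
  rw [measureReal_def, haar_closedBall,
    ENNReal.toReal_ofReal (zpow_pos (cast_prime_pos p) _).le]

theorem setIntegral_sphere {f : ℚ_[p] → ℂ} (hf : Continuous f) (n : ℤ) :
    ∫ ξ in Metric.sphere 0 ((p : ℝ) ^ n), f ξ ∂(haar p) =
      ∫ ξ in Metric.closedBall 0 ((p : ℝ) ^ n), f ξ ∂(haar p) -
        ∫ ξ in Metric.closedBall 0 ((p : ℝ) ^ (n - 1)), f ξ ∂(haar p) := by
  rw [sphere_zpow_eq_diff]
  exact setIntegral_sdiff Metric.isClosed_closedBall.measurableSet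
    (hf.continuousOn.integrableOn_compact (isCompact_closedBall _ _))
    (closedBall_pred_subset p n)

theorem measureReal_sphere_le (n : ℤ) :
    (haar p).real (Metric.sphere 0 ((p : ℝ) ^ n)) ≤ (p : ℝ) ^ n := by
  refine le_of_le_of_eq ?_ (measureReal_closedBall p n)
  exact measureReal_mono Metric.sphere_subset_closedBall (isCompact_closedBall _ _).measure_ne_top

theorem iUnion_sphere : ⋃ n : ℤ, Metric.sphere (0 : ℚ_[p]) ((p : ℝ) ^ n) = {0}ᶜ := by
  ext ξ
  simp only [Set.mem_iUnion, mem_sphere_zero_iff_norm, Set.mem_compl_iff, Set.mem_singleton_iff]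
  constructor
  · rintro ⟨n, hn⟩
    rw [← ne_eq, ← norm_pos_iff, hn]
    exact zpow_pos (cast_prime_pos p) _
  · intro h
    exact ⟨_, Padic.norm_eq_zpow_neg_valuation h⟩

/-- Integration over `ℚ_p` sphere by sphere. -/
theorem hasSum_setIntegral_sphere {f : ℚ_[p] → ℂ} {g : ℤ → ℚ_[p] → ℂ} {C : ℤ → ℝ}
    (hg : ∀ n, Continuous (g n)) (hfg : ∀ n ξ, ‖ξ‖ = (p : ℝ) ^ n → f ξ = g n ξ)
    (hgC : ∀ n ξ, ‖ξ‖ = (p : ℝ) ^ n → ‖g n ξ‖ ≤ C n) (hC : Summable fun n => C n * (p : ℝ) ^ n) :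
    HasSum (fun n : ℤ => ∫ ξ in Metric.sphere 0 ((p : ℝ) ^ n), g n ξ ∂(haar p))
      (∫ ξ, f ξ ∂(haar p)) := by
  have hm : ∀ n : ℤ, MeasurableSet (Metric.sphere (0 : ℚ_[p]) ((p : ℝ) ^ n)) :=
    fun n => Metric.isClosed_sphere.measurableSet
  have hEq : ∀ n : ℤ, Set.EqOn (g n) f (Metric.sphere (0 : ℚ_[p]) ((p : ℝ) ^ n)) :=
    fun n ξ hξ => (hfg n ξ (mem_sphere_zero_iff_norm.1 hξ)).symm
  have hd : Pairwise (Function.onFun Disjoint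
      fun n : ℤ => Metric.sphere (0 : ℚ_[p]) ((p : ℝ) ^ n)) := by
    intro m n hmn
    refine Set.disjoint_left.2 fun ξ h1 h2 => hmn ?_
    rw [mem_sphere_zero_iff_norm] at h1 h2
    exact zpow_right_injective₀ (cast_prime_pos p) (one_lt_cast_prime p).ne' (h1.symm.trans h2)
  have hi : ∀ n : ℤ, IntegrableOn f (Metric.sphere (0 : ℚ_[p]) ((p : ℝ) ^ n)) (haar p) :=
    fun n => ((hg n).continuousOn.integrableOn_compact (isCompact_sphere _ _)).congr_fun (hEq n)
      (hm n)
  have hCn : ∀ n : ℤ, ∫ ξ in Metric.sphere 0 ((p : ℝ) ^ n), ‖f ξ‖ ∂(haar p) ≤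
      C n * (p : ℝ) ^ n := by
    intro n
    -- The point `p ^ (-n)` lies on the sphere, so `C n` bounds some norm.
    have hC0 : 0 ≤ C n := by
      refine (norm_nonneg (g n ((p : ℚ_[p]) ^ (-n)))).trans (hgC n _ ?_)
      rw [norm_p_zpow, neg_neg]
    calc ∫ ξ in Metric.sphere 0 ((p : ℝ) ^ n), ‖f ξ‖ ∂(haar p)
        ≤ ∫ ξ in Metric.sphere 0 ((p : ℝ) ^ n), C n ∂(haar p) := by
          refine setIntegral_mono_on (hi n).norm
            (integrableOn_const (isCompact_sphere _ _).measure_ne_top) (hm n) fun ξ hξ => ?_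
          rw [← hEq n hξ]
          exact hgC n ξ (mem_sphere_zero_iff_norm.1 hξ)
      _ ≤ C n * (p : ℝ) ^ n := by
          rw [setIntegral_const, smul_eq_mul, mul_comm]
          exact mul_le_mul_of_nonneg_left (measureReal_sphere_le p n) hC0
  have hint : IntegrableOn f (⋃ n : ℤ, Metric.sphere (0 : ℚ_[p]) ((p : ℝ) ^ n)) (haar p) :=
    integrableOn_iUnion_of_summable_integral_norm hi
      (hC.of_nonneg_of_le (fun n => integral_nonneg fun _ => norm_nonneg _) hCn)
  have h := hasSum_integral_iUnion hm hd hint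
  -- The spheres cover everything except the null set `{0}`.
  rw [iUnion_sphere, setIntegral_congr_set (ae_eq_univ.2 (by simp)), setIntegral_univ] at h
  refine h.congr_fun fun n => ?_
  exact setIntegral_congr_fun (hm n) (hEq n)

theorem setIntegral_closedBall_stdChar_of_le {n j : ℤ} (h : n ≤ j) :
    ∫ ξ in Metric.closedBall 0 ((p : ℝ) ^ n), stdChar p ((p : ℚ_[p]) ^ j * ξ) ∂(haar p) =
      (p : ℂ) ^ n := by
  rw [setIntegral_congr_fun (g := fun _ => (1 : ℂ)) Metric.isClosed_closedBall.measurableSet,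
    setIntegral_const, measureReal_closedBall]
  · simp
  · intro ξ hξ
    refine stdChar_eq_one p _ ?_
    rw [mem_closedBall_zero_iff] at hξ
    rw [norm_mul, norm_p_zpow]
    calc _ ≤ (p : ℝ) ^ (-j) * (p : ℝ) ^ n := by gcongr
      _ = (p : ℝ) ^ (-j + n) := (zpow_add₀ (cast_prime_pos p).ne' _ _).symm
      _ ≤ 1 := zpow_le_one_of_nonpos₀ (one_lt_cast_prime p).le (by lia)

/-- The character is nontrivial on the ball: a translation preserving the ball multiplies the
integral by a constant other than `1`. -/
theorem setIntegral_closedBall_stdChar_of_lt {n j : ℤ} (h : j < n) :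
    ∫ ξ in Metric.closedBall 0 ((p : ℝ) ^ n), stdChar p ((p : ℚ_[p]) ^ j * ξ) ∂(haar p) = 0 := by
  classical
  have hp0 : (p : ℚ_[p]) ≠ 0 := by exact_mod_cast (Fact.out : p.Prime).ne_zero
  -- Chosen so that `p ^ j * t = p⁻¹`, where the character is not `1`, and `|t| = p ^ (j + 1) ≤ p ^
  -- n`.
  set t : ℚ_[p] := (p : ℚ_[p]) ^ (-(j + 1)) with ht
  have h1 : ‖t‖ ≤ (p : ℝ) ^ n := by
    rw [ht, norm_p_zpow, neg_neg]
    exact zpow_le_zpow_right₀ (one_lt_cast_prime p).le (by lia)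
  have hball : ∀ ξ, ξ + t ∈ Metric.closedBall (0 : ℚ_[p]) ((p : ℝ) ^ n) ↔
      ξ ∈ Metric.closedBall (0 : ℚ_[p]) ((p : ℝ) ^ n) := by
    intro ξ
    simp only [mem_closedBall_zero_iff]
    constructor
    · intro h2
      have : ξ = (ξ + t) + -t := by ring
      rw [this]
      exact (Padic.nonarchimedean _ _).trans (max_le h2 (by rwa [norm_neg]))
    · intro h2
      exact (Padic.nonarchimedean _ _).trans (max_le h2 h1)
  rw [← integral_indicator Metric.isClosed_closedBall.measurableSet]
  set F := Set.indicator (Metric.closedBall (0 : ℚ_[p]) ((p : ℝ) ^ n))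
    (fun ξ => stdChar p ((p : ℚ_[p]) ^ j * ξ)) with hF
  have hFt : ∀ ξ, F (ξ + t) = stdChar p ((p : ℚ_[p])⁻¹) * F ξ := by
    intro ξ
    simp only [hF, Set.indicator_apply, hball]
    split_ifs
    · rw [mul_add, stdChar_add, ht, ← zpow_add₀ hp0, mul_comm]
      congr 2
      rw [show j + -(j + 1) = -1 by ring, zpow_neg_one]
    · simp
  have key := integral_add_right_eq_self (μ := haar p) F t
  simp only [hFt] at key
  rw [integral_const_mul] at key
  by_contra hI
  exact stdChar_inv_p_ne_one p (mul_right_cancel₀ hI (key.trans (one_mul _).symm))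

theorem continuous_stdChar_mul (x : ℚ_[p]) : Continuous fun ξ => stdChar p (x * ξ) :=
  (continuous_stdChar p).comp (continuous_const.mul continuous_id)

theorem integral_wavelet (n : ℤ) : ∫ ξ, wavelet p n ξ ∂(haar p) = 0 := by
  rw [wavelet_eq, integral_indicator Metric.isClosed_closedBall.measurableSet,
    integral_const_mul, setIntegral_closedBall_stdChar_of_lt p (by lia), mul_zero]

end Spheres
-- The twisted gamma function
section Gamma
variable (p : ℕ) [Fact p.Prime]

theorem cast_prime_ne_zero : (p : ℂ) ≠ 0 := by exact_mod_cast (Fact.out : p.Prime).ne_zero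

variable {p}

theorem valuation_of_norm_eq {ξ : ℚ_[p]} {n : ℤ} (h : ‖ξ‖ = (p : ℝ) ^ n) : ξ.valuation = -n := by
  have h0 : ξ ≠ 0 := norm_pos_iff.1 (h ▸ zpow_pos (cast_prime_pos p) _)
  rw [Padic.norm_eq_zpow_neg_valuation h0] at h
  have := zpow_right_injective₀ (cast_prime_pos p) (one_lt_cast_prime p).ne' h
  lia

/-- The base is a positive real, so no branch of the logarithm interferes; the weight becomes a
geometric sequence in the index of the sphere. -/
theorem norm_cpow_of_norm_eq {ξ : ℚ_[p]} {n : ℤ} (h : ‖ξ‖ = (p : ℝ) ^ n) (s : ℂ) :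
    ((‖ξ‖ : ℝ) : ℂ) ^ s = ((p : ℂ) ^ s) ^ n := by
  rw [h, ← Complex.cpow_mul_int, mul_comm, Complex.ofReal_zpow, Complex.ofReal_natCast,
    Complex.cpow_int_mul, Complex.cpow_def_of_ne_zero (zpow_ne_zero _ (cast_prime_ne_zero p)),
    Complex.cpow_def_of_ne_zero (cast_prime_ne_zero p), ← Complex.exp_int_mul]
  have : Complex.log ((p : ℂ) ^ n) = n * Complex.log p := by
    rw [← Complex.ofReal_natCast, ← Complex.ofReal_zpow, ← Complex.ofReal_log
      (zpow_pos (cast_prime_pos p) _).le, Real.log_zpow, ← Complex.ofReal_log (cast_prime_pos p).le]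
    push_cast; rfl
  rw [this]
  ring_nf

theorem norm_cast_prime_cpow (s : ℂ) : ‖(p : ℂ) ^ s‖ = (p : ℝ) ^ s.re := by
  rw [← Complex.ofReal_natCast, Complex.norm_cpow_eq_rpow_re_of_pos (cast_prime_pos p)]

theorem cast_prime_cpow_ne_zero (s : ℂ) : (p : ℂ) ^ s ≠ 0 := by
  rw [Complex.cpow_def_of_ne_zero (cast_prime_ne_zero p)]
  exact Complex.exp_ne_zero _

/-- The summability of a two-sided geometric progression cut off on the right. -/
theorem summable_geometric_le {r : ℝ} (hr : 1 < r) (M : ℤ) :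
    Summable fun n : ℤ => if n ≤ M then r ^ n else 0 := by
  have hinj : Function.Injective fun m : ℕ => M - (m : ℤ) := fun a b h => by simpa using h
  rw [← hinj.summable_iff]
  · have : (fun n : ℤ => if n ≤ M then r ^ n else 0) ∘ (fun m : ℕ => M - (m : ℤ)) =
        fun m : ℕ => r ^ M * (r⁻¹) ^ m := by
      ext m
      simp [zpow_sub₀ (zero_lt_one.trans hr).ne', div_eq_mul_inv]
    rw [this]
    exact (summable_geometric_of_lt_one (by positivity) (inv_lt_one_of_one_lt₀ hr)).mul_left _
  · intro n hn
    rw [if_neg]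
    intro h
    exact hn ⟨(M - n).toNat, by simp; lia⟩

theorem summable_geometric_ge {r : ℝ} (hr0 : 0 < r) (hr : r < 1) (M : ℤ) :
    Summable fun n : ℤ => if M ≤ n then r ^ n else 0 := by
  have h := summable_geometric_le ((one_lt_inv₀ hr0).2 hr) (-M)
  rw [← (Equiv.neg ℤ).summable_iff] at h
  refine h.congr fun n => ?_
  simp

variable (p) in
/-- The integral of `ξ ↦ e^{2πiξ} t^n` (`|ξ|_p = p ^ n`) over a large ball. -/
theorem setIntegral_stdChar_mul_radial {t : ℂ} (ht : 1 < ‖p * t‖) {w : ℚ_[p] → ℂ}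
    (hw : ∀ (n : ℤ) (ξ : ℚ_[p]), ‖ξ‖ = (p : ℝ) ^ n → w ξ = t ^ n) {M : ℤ} (hM : 1 ≤ M) :
    ∫ ξ in Metric.closedBall (0 : ℚ_[p]) ((p : ℝ) ^ M), stdChar p ξ * w ξ ∂(haar p) =
      (1 - t) / (1 - (p * t)⁻¹) := by
  classical
  have hp0 := cast_prime_ne_zero p
  have ht0 : t ≠ 0 := by rintro rfl; simp at ht; linarith
  rw [← integral_indicator Metric.isClosed_closedBall.measurableSet]
  have key := hasSum_setIntegral_sphere p
    (f := Set.indicator (Metric.closedBall (0 : ℚ_[p]) ((p : ℝ) ^ M)) fun ξ => stdChar p ξ * w ξ)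
    (g := fun n ξ => (if n ≤ M then t ^ n else 0) * stdChar p ((p : ℚ_[p]) ^ (0 : ℤ) * ξ))
    (C := fun n => if n ≤ M then ‖t‖ ^ n else 0)
    (fun n => continuous_const.mul (continuous_stdChar_mul p _)) ?_ ?_ ?_
  · refine key.unique ?_
    -- Only spheres of radius at most `p` contribute, indexed by `n = 1 - m`. The term `m = 0`, the
    -- sphere of radius `p`, is exceptional: the character integrates to `-1` there. The remaining
    -- terms form a geometric series of ratio `(p t)⁻¹`.
    have hinj : Function.Injective fun m : ℕ => 1 - (m : ℤ) := fun a b h => by simpa using h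
    simp_rw [integral_const_mul, setIntegral_sphere p (continuous_stdChar_mul p _)]
    rw [← hinj.hasSum_iff]
    · rw [← hasSum_nat_add_iff' 1]
      have hr : ‖(p * t)⁻¹‖ < 1 := by rw [norm_inv]; exact inv_lt_one_of_one_lt₀ ht
      have hr1 : 1 - (p * t)⁻¹ ≠ 0 := sub_ne_zero.2 fun h => by rw [← h] at hr; simp at hr
      rw [show (1 - t) / (1 - (p * t)⁻¹) - _ = (1 - (p : ℂ)⁻¹) * (1 - (p * t)⁻¹)⁻¹ from ?_]
      · refine ((hasSum_geometric_of_norm_lt_one hr).mul_left (1 - (p : ℂ)⁻¹)).congr_fun fun m => ?_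
        simp only [Function.comp_apply]
        rw [if_pos (by push_cast; lia), setIntegral_closedBall_stdChar_of_le p (by push_cast; lia),
          setIntegral_closedBall_stdChar_of_le p (by push_cast; lia),
          show (1 : ℤ) - ((m + 1 : ℕ) : ℤ) = -m by push_cast; ring, zpow_sub₀ hp0, zpow_neg,
          zpow_neg, zpow_natCast, zpow_natCast, inv_pow, mul_pow]
        field_simp
      · simp only [Finset.range_one, Finset.sum_singleton, Function.comp_apply, Nat.cast_zero,
          sub_zero, sub_self]
        rw [if_pos hM, setIntegral_closedBall_stdChar_of_le p le_rfl,
          setIntegral_closedBall_stdChar_of_lt p zero_lt_one]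
        rw [← div_eq_mul_inv, eq_div_iff hr1, sub_mul, div_mul_cancel₀ _ hr1]
        field_simp
        ring
    · intro n hn
      have hn1 : 1 < n := by
        by_contra h
        exact hn ⟨(1 - n).toNat, by simp; lia⟩
      rw [setIntegral_closedBall_stdChar_of_lt p (by lia),
        setIntegral_closedBall_stdChar_of_lt p (by lia), sub_self, mul_zero]
  · intro n ξ h
    simp only [Set.indicator_apply, mem_closedBall_zero_iff, h,
      zpow_le_zpow_iff_right₀ (one_lt_cast_prime p)]
    split_ifs
    · rw [hw n ξ h, zpow_zero, one_mul, mul_comm]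
    · simp
  · intro n ξ _
    rw [norm_mul, norm_stdChar, mul_one]
    split_ifs <;> simp
  · refine (summable_geometric_le ht M).congr fun n => ?_
    split_ifs
    · rw [norm_mul, Complex.norm_natCast, mul_zpow, mul_comm]
    · simp

variable (p)

/-- The integrals over the balls are already constant from `M = 1` on, so the limit is immediate;
here `t = p^(s-1) / a`. -/
theorem gammaIntegral_eq {a s : ℂ} (ha : a ≠ 0) (hs : ‖a‖ < (p : ℝ) ^ s.re) :
    gammaIntegral p a s = (1 - (p : ℂ) ^ (s - 1) / a) / (1 - a * (p : ℂ) ^ (-s)) := by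
  have hp0 := cast_prime_ne_zero p
  have hpt : (p : ℂ) * ((p : ℂ) ^ (s - 1) / a) = (p : ℂ) ^ s / a := by
    rw [Complex.cpow_sub _ _ hp0, Complex.cpow_one]; field_simp
  have hval : ∀ M : ℕ, 1 ≤ M →
      ∫ ξ in Metric.closedBall (0 : ℚ_[p]) ((p : ℝ) ^ M),
        stdChar p ξ * ((‖ξ‖ : ℝ) : ℂ) ^ (s - 1) * extChar a ξ.valuation ∂(haar p) =
      (1 - (p : ℂ) ^ (s - 1) / a) / (1 - a * (p : ℂ) ^ (-s)) := by
    intro M hM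
    simp_rw [mul_assoc]
    have := setIntegral_stdChar_mul_radial p (t := (p : ℂ) ^ (s - 1) / a)
      (w := fun ξ => ((‖ξ‖ : ℝ) : ℂ) ^ (s - 1) * extChar a ξ.valuation) ?_ ?_ (M := M)
      (by exact_mod_cast hM)
    · rw [zpow_natCast] at this
      rw [this, hpt, inv_div, Complex.cpow_neg, div_eq_mul_inv a]
    · rw [hpt, norm_div, norm_cast_prime_cpow]
      exact (one_lt_div (norm_pos_iff.2 ha)).2 hs
    · intro n ξ h
      rw [norm_cpow_of_norm_eq h, valuation_of_norm_eq h, extChar, if_neg ha, zpow_neg, div_zpow,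
        div_eq_mul_inv]
  refine Filter.Tendsto.limUnder_eq (tendsto_const_nhds.congr' ?_)
  filter_upwards [Filter.eventually_ge_atTop 1] with M hM
  exact (hval M hM).symm

theorem differentiable_cpow_const_base : Differentiable ℂ fun s : ℂ => (p : ℂ) ^ s :=
  fun _ => (differentiableAt_id).const_cpow (Or.inl (cast_prime_ne_zero p))

theorem countable_setOf_mul_cpow_neg_eq_one (a : ℂ) : {s : ℂ | a * (p : ℂ) ^ (-s) = 1}.Countable := by
  have hlog : Complex.log p ≠ 0 := by
    rw [← Complex.ofReal_natCast, ← Complex.ofReal_log (cast_prime_pos p).le]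
    exact_mod_cast (Real.log_pos (one_lt_cast_prime p)).ne'
  refine (Set.countable_range fun n : ℤ =>
    (Complex.log a + n * (2 * Real.pi * Complex.I)) / Complex.log p).mono fun s hs => ?_
  have hs : a * (p : ℂ) ^ (-s) = 1 := hs
  have ha : a ≠ 0 := by rintro rfl; simp at hs
  have h1 : Complex.exp (Complex.log p * s) = Complex.exp (Complex.log a) := by
    rw [Complex.exp_log ha, ← Complex.cpow_def_of_ne_zero (cast_prime_ne_zero p)]
    rw [Complex.cpow_neg] at hs
    exact ((mul_inv_eq_one₀ (cast_prime_cpow_ne_zero s)).1 hs).symm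
  obtain ⟨n, hn⟩ := Complex.exp_eq_exp_iff_exists_int.1 h1
  exact ⟨n, by simp only [← hn]; field_simp⟩

/-- The closed form is holomorphic off the countable set `a p^(-s) = 1`, which misses the region of
convergence because there `|a p^(-s)| < 1`. -/
theorem twistedGamma_eq {a s : ℂ} (ha : a ≠ 0) (hs : a * (p : ℂ) ^ (-s) ≠ 1) :
    twistedGamma p a s = (1 - (p : ℂ) ^ (s - 1) / a) / (1 - a * (p : ℂ) ^ (-s)) := by
  have hp := cast_prime_pos p
  have hd := differentiable_cpow_const_base p
  have hd' : Differentiable ℂ fun s : ℂ => a * (p : ℂ) ^ (-s) :=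
    (hd.comp differentiable_neg).const_mul a
  refine continuation_eq (S := {s : ℂ | a * (p : ℂ) ^ (-s) = 1})
    (G := fun s => (1 - (p : ℂ) ^ (s - 1) / a) / (1 - a * (p : ℂ) ^ (-s))) ?_ ?_
    (countable_setOf_mul_cpow_neg_eq_one p a)
    (isClosed_eq hd'.continuous continuous_const) ?_ hs ?_ fun s hs => ?_
  · simp_rw [← norm_cast_prime_cpow]
    exact isOpen_lt continuous_const hd.continuous.norm
  · obtain ⟨n, hn⟩ := pow_unbounded_of_one_lt ‖a‖ (one_lt_cast_prime p)
    exact ⟨n, by simpa using hn⟩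
  · refine Set.disjoint_left.2 fun s (h1 : ‖a‖ < _) (h2 : a * (p : ℂ) ^ (-s) = 1) => ?_
    have := congrArg norm h2
    rw [norm_mul, norm_cast_prime_cpow, Complex.neg_re, Real.rpow_neg hp.le, norm_one,
      mul_inv_eq_one₀ (by positivity)] at this
    exact h1.ne this
  · refine DifferentiableOn.div ?_ ?_ fun s hs => sub_ne_zero.2 fun h => hs h.symm
    · exact ((((hd.comp (differentiable_id.sub_const 1))).div_const a).const_sub 1).differentiableOn
    · exact (hd'.const_sub 1).differentiableOn
  · exact (gammaIntegral_eq p ha hs).symm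

end Gamma
-- Wavelets as eigenfunctions of the twisted derivative
section Eigenvalue
variable (p : ℕ) [Fact p.Prime]

theorem add_mem_closedBall_iff {r : ℝ} {ξ : ℚ_[p]} (hξ : ‖ξ‖ ≤ r) (u : ℚ_[p]) :
    ξ + u ∈ Metric.closedBall (0 : ℚ_[p]) r ↔ ‖u‖ ≤ r := by
  rw [mem_closedBall_zero_iff]
  constructor
  · intro h
    have : u = (ξ + u) + -ξ := by ring
    rw [this]
    exact (Padic.nonarchimedean _ _).trans (max_le h (by rwa [norm_neg]))
  · exact fun h => (Padic.nonarchimedean _ _).trans (max_le hξ h)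

theorem wavelet_add_of_norm_le {n : ℤ} {ξ u : ℚ_[p]} (hξ : ‖ξ‖ ≤ (p : ℝ) ^ n)
    (hu : ‖u‖ ≤ (p : ℝ) ^ n) :
    wavelet p n (ξ + u) = wavelet p n ξ * stdChar p ((p : ℚ_[p]) ^ (n - 1) * u) := by
  rw [wavelet_eq, Set.indicator_of_mem ((add_mem_closedBall_iff p hξ u).2 hu),
    Set.indicator_of_mem (mem_closedBall_zero_iff.2 hξ), mul_add, stdChar_add, mul_assoc]

theorem wavelet_add_of_lt_norm {n : ℤ} {ξ u : ℚ_[p]} (hξ : ‖ξ‖ ≤ (p : ℝ) ^ n)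
    (hu : (p : ℝ) ^ n < ‖u‖) : wavelet p n (ξ + u) = 0 := by
  rw [wavelet_eq, Set.indicator_of_notMem]
  exact fun h => absurd ((add_mem_closedBall_iff p hξ u).1 h) (not_le.2 hu)

theorem wavelet_of_lt_norm {n : ℤ} {ξ : ℚ_[p]} (hξ : (p : ℝ) ^ n < ‖ξ‖) : wavelet p n ξ = 0 := by
  rw [wavelet_eq, Set.indicator_of_notMem]
  rwa [mem_closedBall_zero_iff, not_le]

theorem setIntegral_closedBall_stdChar_sub_one (c : ℂ) (j k : ℤ) :
    ∫ ξ in Metric.closedBall 0 ((p : ℝ) ^ k), (c * stdChar p ((p : ℚ_[p]) ^ j * ξ) - 1) ∂(haar p) =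
      c * ∫ ξ in Metric.closedBall 0 ((p : ℝ) ^ k), stdChar p ((p : ℚ_[p]) ^ j * ξ) ∂(haar p) -
        (p : ℂ) ^ k := by
  have hc := isCompact_closedBall (0 : ℚ_[p]) ((p : ℝ) ^ k)
  rw [integral_sub, integral_const_mul, setIntegral_const, measureReal_closedBall]
  · simp
  · exact (continuous_const.mul (continuous_stdChar_mul p _)).continuousOn.integrableOn_compact hc
  · exact integrableOn_const hc.measure_ne_top

/-- The integral of the difference of a wavelet against a radial weight, inside the support. -/
theorem integral_wavelet_sub_mul_radial {t : ℂ} (ht0 : t ≠ 0) (ht : ‖p * t‖ < 1) {w : ℚ_[p] → ℂ}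
    (hw : ∀ (k : ℤ) (u : ℚ_[p]), ‖u‖ = (p : ℝ) ^ k → w u = t ^ k) {n : ℤ} {ξ : ℚ_[p]}
    (hξ : ‖ξ‖ ≤ (p : ℝ) ^ n) :
    ∫ u, (wavelet p n (ξ + u) - wavelet p n ξ) * w u ∂(haar p) =
      -((p * t) ^ n * (1 - t) / (1 - p * t)) * wavelet p n ξ := by
  have hp0 := cast_prime_ne_zero p
  have hp1 := one_lt_cast_prime p
  have hpt0 : 0 < ‖p * t‖ := norm_pos_iff.2 (mul_ne_zero hp0 ht0)
  set c := wavelet p n ξ with hc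
  have hcont : ∀ k : ℤ, Continuous fun u : ℚ_[p] =>
      (if k ≤ n then (1 : ℂ) else 0) * stdChar p ((p : ℚ_[p]) ^ (n - 1) * u) - 1 :=
    fun k => (continuous_const.mul (continuous_stdChar_mul p _)).sub continuous_const
  have key := hasSum_setIntegral_sphere p
    (f := fun u => (wavelet p n (ξ + u) - wavelet p n ξ) * w u)
    -- For `|u| < p ^ n` the wavelet does not change under the shift by `u`; on `|u| = p ^ n` it is
    -- multiplied by a character; beyond that the shifted wavelet vanishes and only `-c` is left.
    (g := fun k u => (if n ≤ k then c * t ^ k else 0) *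
      ((if k ≤ n then 1 else 0) * stdChar p ((p : ℚ_[p]) ^ (n - 1) * u) - 1))
    (C := fun k => if n ≤ k then ‖c‖ * ‖t‖ ^ k * 2 else 0)
    (fun k => continuous_const.mul (hcont k)) ?_ ?_ ?_
  · refine key.unique ?_
    have hinj : Function.Injective fun m : ℕ => n + (m : ℤ) := fun a b h => by simpa using h
    have hr1 : 1 - p * t ≠ 0 := sub_ne_zero.2 fun h => by rw [← h] at ht; simp at ht
    simp_rw [integral_const_mul, setIntegral_sphere p (hcont _),
      setIntegral_closedBall_stdChar_sub_one]
    rw [← hinj.hasSum_iff]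
    -- The sphere `|u| = p ^ n` is split off: it contributes `-c (p t)^n`. The larger spheres form a
    -- geometric series of ratio `p t`.
    · rw [← hasSum_nat_add_iff' 1]
      rw [show -((p * t) ^ n * (1 - t) / (1 - p * t)) * c - _ =
        -(c * (p * t) ^ n * (1 - (p : ℂ)⁻¹) * (p * t)) * (1 - p * t)⁻¹ from ?_]
      · refine ((hasSum_geometric_of_norm_lt_one ht).mul_left _).congr_fun fun m => ?_
        simp only [Function.comp_apply]
        rw [if_pos (by lia), if_neg (by push_cast; lia), zero_mul, zero_mul, zpow_sub₀ hp0,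
          zpow_one, ← zpow_natCast, mul_zpow, mul_zpow,
          show n + ((m + 1 : ℕ) : ℤ) = n + m + 1 by push_cast; ring, zpow_add₀ ht0, zpow_add₀ hp0,
          zpow_add₀ ht0, zpow_add₀ hp0, zpow_one, zpow_one]
        field_simp
        ring
      · simp only [Finset.range_one, Finset.sum_singleton, Function.comp_apply, Nat.cast_zero,
          add_zero]
        rw [if_pos le_rfl, if_pos le_rfl, setIntegral_closedBall_stdChar_of_lt p (by lia),
          setIntegral_closedBall_stdChar_of_le p le_rfl, mul_zpow]
        linear_combination (-(c * (p : ℂ) ^ n * t ^ n)) * mul_inv_cancel₀ hr1 -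
          c * (p : ℂ) ^ n * t ^ n * t * (1 - p * t)⁻¹ * inv_mul_cancel₀ hp0
    · intro k hk
      have hk1 : ¬ n ≤ k := fun h => hk ⟨(k - n).toNat, by simp; lia⟩
      rw [if_neg hk1, zero_mul]
  · intro k u h
    rw [hw k u h]
    rcases lt_trichotomy k n with hk | rfl | hk
    · rw [if_neg (not_le.2 hk), wavelet_add_of_norm_le p hξ
        (h.le.trans (zpow_le_zpow_right₀ hp1.le hk.le)), stdChar_eq_one]
      · simp
      · rw [norm_mul, norm_p_zpow, h, ← zpow_add₀ (cast_prime_pos p).ne']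
        exact zpow_le_one_of_nonpos₀ hp1.le (by lia)
    · rw [if_pos le_rfl, if_pos le_rfl, wavelet_add_of_norm_le p hξ h.le]
      ring
    · rw [if_pos hk.le, if_neg (not_le.2 hk), wavelet_add_of_lt_norm p hξ
        (h ▸ zpow_lt_zpow_right₀ hp1 hk)]
      ring
  · intro k u _
    rw [norm_mul]
    split_ifs
    · rw [norm_mul, norm_zpow, one_mul]
      gcongr
      refine (norm_sub_le _ _).trans ?_
      rw [norm_stdChar, norm_one]; norm_num
    · rw [norm_mul, norm_zpow]
      gcongr; simp
    · simp
    · simp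
  · refine ((summable_geometric_ge hpt0 ht n).mul_left (‖c‖ * 2)).congr fun k => ?_
    split_ifs
    · rw [norm_mul, Complex.norm_natCast, mul_zpow]; ring
    · simp

/-- The integral of the difference of a wavelet against a radial weight, outside the support. -/
theorem integral_wavelet_sub_mul_radial_of_lt {t : ℂ} {w : ℚ_[p] → ℂ}
    (hw : ∀ (k : ℤ) (u : ℚ_[p]), ‖u‖ = (p : ℝ) ^ k → w u = t ^ k) {n : ℤ} {ξ : ℚ_[p]}
    (hξ : (p : ℝ) ^ n < ‖ξ‖) :
    ∫ η, (wavelet p n η - wavelet p n ξ) * w (η - ξ) ∂(haar p) = 0 := by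
  have h0 : ξ ≠ 0 := norm_pos_iff.1 ((zpow_pos (cast_prime_pos p) _).trans hξ)
  have hξn := Padic.norm_eq_zpow_neg_valuation h0
  have h : ∀ η, (wavelet p n η - wavelet p n ξ) * w (η - ξ) =
      wavelet p n η * t ^ (-ξ.valuation) := by
    intro η
    rw [wavelet_of_lt_norm p hξ, sub_zero]
    rcases le_or_gt ‖η‖ ((p : ℝ) ^ n) with h1 | h1
    -- Here `|η - ξ| = |ξ|` by the ultrametric inequality, so the weight is constant on the support
    -- of the wavelet, whose integral is zero.
    · rw [hw]
      rw [← hξn, sub_eq_add_neg, Padic.add_eq_max_of_ne, norm_neg]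
      · exact max_eq_right (h1.trans hξ.le)
      · rw [norm_neg]; exact (h1.trans_lt hξ).ne
    · rw [wavelet_of_lt_norm p h1, zero_mul, zero_mul]
  simp_rw [h]
  rw [integral_mul_const, integral_wavelet, zero_mul]

/-- The integral and the gamma factor share the numerator `1 - t`, and `1 - a p^β = 1 - (p t)⁻¹`;
the quotient collapses to `(p t)^(n-1)`. -/
theorem vladimirovIntegral_wavelet {a β : ℂ} (ha : a ≠ 0) (hβ : 1 < ‖a‖ * (p : ℝ) ^ β.re)
    (n : ℤ) (ξ : ℚ_[p]) :
    vladimirovIntegral p a β (wavelet p n) ξ = (a * (p : ℂ) ^ β) ^ (1 - n) * wavelet p n ξ := by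
  have hp0 := cast_prime_ne_zero p
  set t : ℂ := (p : ℂ) ^ (-β - 1) / a with ht
  have hpβ := cast_prime_cpow_ne_zero (p := p) β
  have hpt : p * t = (a * (p : ℂ) ^ β)⁻¹ := by
    rw [ht, Complex.cpow_sub _ _ hp0, Complex.cpow_one, Complex.cpow_neg]; field_simp
  have ht0 : t ≠ 0 := div_ne_zero (cast_prime_cpow_ne_zero _) ha
  have hn : ‖p * t‖ < 1 := by
    rw [hpt, norm_inv, norm_mul, norm_cast_prime_cpow]
    exact inv_lt_one_of_one_lt₀ hβ
  have hr1 : 1 - p * t ≠ 0 := sub_ne_zero.2 fun h => by rw [← h] at hn; simp at hn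
  have hpt0 : p * t ≠ 0 := mul_ne_zero hp0 ht0
  have hval : a * (p : ℂ) ^ β = (p * t)⁻¹ := by rw [hpt, inv_inv]
  -- The gamma factor does not vanish: `t = 1` would give `|p t| = p > 1`.
  have ht1 : 1 - t ≠ 0 := by
    refine sub_ne_zero.2 fun h => ?_
    rw [← h, mul_one, Complex.norm_natCast] at hn
    exact absurd hn (one_lt_cast_prime p).not_gt
  let w : ℚ_[p] → ℂ := fun u => (((‖u‖ : ℝ) : ℂ) ^ (β + 1))⁻¹ * extChar a u.valuation
  have hw : ∀ (k : ℤ) (u : ℚ_[p]), ‖u‖ = (p : ℝ) ^ k → w u = t ^ k := by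
    intro k u h
    simp only [w]
    rw [norm_cpow_of_norm_eq h, valuation_of_norm_eq h, extChar, if_neg ha, ht,
      show -β - 1 = -(β + 1) by ring, Complex.cpow_neg, div_zpow, inv_zpow, zpow_neg,
      div_eq_mul_inv]
  have hint : ∫ η, (wavelet p n η - wavelet p n ξ) / ((‖η - ξ‖ : ℝ) : ℂ) ^ (β + 1) *
      extChar a (η - ξ).valuation ∂(haar p) =
      ∫ η, (wavelet p n η - wavelet p n ξ) * w (η - ξ) ∂(haar p) := by
    simp only [w, div_eq_mul_inv, mul_assoc]
  -- In this half-plane `-β` lies outside the region of convergence of the gamma integral, so the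
  -- continued value of the gamma function is essential.
  rw [vladimirovIntegral, hint, twistedGamma_eq p ha (by
    rw [neg_neg, hval, ne_eq, inv_eq_one]; exact fun h => hr1 (by rw [h, sub_self])), neg_neg,
    ← ht, hval]
  rcases le_or_gt ‖ξ‖ ((p : ℝ) ^ n) with h | h
  · have hshift := integral_add_left_eq_self (μ := haar p)
      (fun η => (wavelet p n η - wavelet p n ξ) * w (η - ξ)) ξ
    simp only [add_sub_cancel_left] at hshift
    rw [← hshift, integral_wavelet_sub_mul_radial p ht0 hn hw h, inv_zpow, ← zpow_neg, neg_sub,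
      zpow_sub₀ hpt0, zpow_one, inv_div]
    have hr2 : p * t - 1 ≠ 0 := fun h => hr1 (by rw [← neg_sub, h, neg_zero])
    field_simp
    ring
  · rw [integral_wavelet_sub_mul_radial_of_lt p hw h, wavelet_of_lt_norm p h, mul_zero, mul_zero]

/-- The wavelets are eigenfunctions of the twisted Vladimirov derivative. -/
theorem vladimirov_wavelet {a : ℂ} (ha : a ≠ 0) (α : ℂ) (n : ℤ) (ξ : ℚ_[p]) :
    vladimirov p a α (wavelet p n) ξ = (a * (p : ℂ) ^ α) ^ (1 - n) * wavelet p n ξ := by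
  have hd := (differentiable_cpow_const_base p).const_mul a
  rw [vladimirov, if_neg ha]
  -- The eigenvalue is an integer power of the nowhere vanishing entire function `a p^β`, so there
  -- are no singularities.
  refine continuation_eq (S := ∅)
    (G := fun β => (a * (p : ℂ) ^ β) ^ (1 - n) * wavelet p n ξ) ?_ ?_ Set.countable_empty
    isClosed_empty (Set.disjoint_empty _) (Set.notMem_empty _) ?_ fun β hβ =>
      (vladimirovIntegral_wavelet p ha hβ n ξ).symm
  · simp_rw [← norm_cast_prime_cpow, ← norm_mul]
    exact isOpen_lt continuous_const hd.continuous.norm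
  · obtain ⟨m, hm⟩ := pow_unbounded_of_one_lt ‖a‖⁻¹ (one_lt_cast_prime p)
    refine ⟨m, ?_⟩
    rw [inv_lt_iff_one_lt_mul₀' (norm_pos_iff.2 ha)] at hm
    simpa using hm
  · exact ((hd.zpow (Or.inl fun β => mul_ne_zero ha (cast_prime_cpow_ne_zero β))).mul_const
      _).differentiableOn

end Eigenvalue
-- Basis independence of the trace
section Trace

theorem HasTrace.smul {E : Type} [NormedAddCommGroup E] [InnerProductSpace ℂ E] {T : E →L[ℂ] E}
    {t : ℂ} (h : HasTrace T t) (c : ℂ) : HasTrace (c • T) (c * t) := by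
  intro ι b
  simpa [inner_smul_right] using (h ι b).mul_left c

/-- An absolutely convergent combination of rank one projections has the expected trace. -/
theorem hasTrace_of_hasSum_rankOne {E κ : Type} [NormedAddCommGroup E] [InnerProductSpace ℂ E]
    {T : E →L[ℂ] E} {c : κ → ℂ} {e : κ → E} {t : ℂ} (he : ∀ k, ‖e k‖ = 1)
    (hc : Summable fun k => ‖c k‖) (ht : HasSum c t)
    (hT : ∀ x, HasSum (fun k => c k • inner ℂ (e k) x • e k) (T x)) : HasTrace T t := by
  intro ι b
  have hpars : ∀ k, HasSum (fun i => inner ℂ (e k) (b i) * inner ℂ (b i) (e k)) 1 := by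
    intro k
    have := b.hasSum_inner_mul_inner (e k) (e k)
    rwa [inner_self_eq_norm_sq_to_K, he, RCLike.ofReal_one, one_pow] at this
  have hnorm : ∀ k i, ‖inner ℂ (e k) (b i) * inner ℂ (b i) (e k)‖ =
      (inner ℂ (e k) (b i) * inner ℂ (b i) (e k)).re := by
    intro k i
    rw [← inner_conj_symm (e k) (b i), ← Complex.normSq_eq_conj_mul_self, Complex.ofReal_re,
      Complex.norm_real, Real.norm_of_nonneg (Complex.normSq_nonneg _)]
  have hparsn : ∀ k, HasSum (fun i => ‖inner ℂ (e k) (b i) * inner ℂ (b i) (e k)‖) 1 := by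
    intro k
    simpa only [hnorm, Complex.one_re] using Complex.hasSum_re (hpars k)
  let F : κ × ι → ℂ := fun q => c q.1 * (inner ℂ (e q.1) (b q.2) * inner ℂ (b q.2) (e q.1))
  -- For each `k` the norms over `i` sum to `|c k|` by Parseval, so the double family is absolutely
  -- summable and both orders of summation agree.
  have hF : Summable F := by
    refine Summable.of_norm ((summable_prod_of_nonneg fun _ => norm_nonneg _).2 ⟨fun k => ?_, ?_⟩)
    · simp only [F, norm_mul (c _)]
      exact (hparsn k).summable.mul_left _
    · simp only [F, norm_mul (c _)]
      refine hc.congr fun k => ?_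
      rw [((hparsn k).mul_left ‖c k‖).tsum_eq, mul_one]
  have h1 : HasSum F t := by
    have h2 := hF.hasSum.prod_fiberwise fun k => (hpars k).mul_left (c k)
    simp only [mul_one] at h2
    rw [ht.unique h2]
    exact hF.hasSum
  -- Summing over `k` first gives the diagonal matrix entry of `T` at `b i`.
  have h3 := (Equiv.prodComm ι κ).hasSum_iff.2 h1
  refine h3.prod_fiberwise fun i => ?_
  have h4 := (innerSL ℂ (b i)).hasSum (hT (b i))
  simp only [innerSL_apply_apply, inner_smul_right] at h4
  exact h4

end Trace

/-! ### Diagonal operators on the wavelet basis -/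

section Diagonal
variable (p : ℕ) [Fact p.Prime]

theorem dense_span_ket : Dense (Submodule.span ℂ (Set.range (ket p)) : Set (HMinus p)) := by
  intro x
  have := span_ket_dense p (Submodule.mem_top (x := x))
  rwa [← SetLike.mem_coe, Submodule.topologicalClosure_coe] at this

theorem norm_innerSL_smulRight_self {E : Type} [NormedAddCommGroup E] [InnerProductSpace ℂ E]
    {e : E} (he : ‖e‖ = 1) : ‖(innerSL ℂ e).smulRight e‖ = 1 := by
  rw [ContinuousLinearMap.norm_smulRight_apply, innerSL_apply_norm, he, one_mul]

/-- A family of eigenvalues with absolutely convergent sum on an orthonormal system. -/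
theorem exists_clm_of_orthonormal {E κ : Type} [NormedAddCommGroup E] [InnerProductSpace ℂ E]
    [CompleteSpace E] {e : κ → E} (he : Orthonormal ℂ e) {c : κ → ℂ}
    (hc : Summable fun k => ‖c k‖) :
    ∃ T : E →L[ℂ] E, (∀ k, T (e k) = c k • e k) ∧
      ∀ x, HasSum (fun k => c k • inner ℂ (e k) x • e k) (T x) := by
  classical
  -- The rank one projections have norm `1`, so the series converges in operator norm.
  have hs : Summable fun k => c k • (innerSL ℂ (e k)).smulRight (e k) := by
    refine Summable.of_norm (hc.congr fun k => ?_)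
    rw [norm_smul, norm_innerSL_smulRight_self (he.1 k), mul_one]
  have h : ∀ x, HasSum (fun k => c k • inner ℂ (e k) x • e k)
      ((∑' k, c k • (innerSL ℂ (e k)).smulRight (e k)) x) := by
    intro x
    simpa using (ContinuousLinearMap.apply ℂ E x).hasSum hs.hasSum
  refine ⟨_, fun k => (h (e k)).unique ?_, h⟩
  convert hasSum_single k fun j hj => ?_ using 1
  · rw [inner_self_eq_norm_sq_to_K, he.1, RCLike.ofReal_one, one_pow, one_smul]
  · rw [he.2 hj, zero_smul, smul_zero]

theorem exists_isVladimirovOn {a α : ℂ} (ha : a ≠ 0) (h : ‖a * (p : ℂ) ^ α‖ < 1) :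
    ∃ T, IsVladimirovOn p a α T := by
  obtain ⟨T, hT, -⟩ := exists_clm_of_orthonormal (orthonormal_ket p)
    (c := fun m => (a * (p : ℂ) ^ α) ^ m)
    (by simpa using summable_geometric_of_lt_one (norm_nonneg _) h)
  refine ⟨T, fun m => ?_⟩
  rw [hT]
  have h1 := Lp.coeFn_smul ((a * (p : ℂ) ^ α) ^ m) (waveletL2 p (1 - m))
  filter_upwards [h1, (memLp_wavelet p (1 - m)).coeFn_toLp] with ξ h2 h3
  rw [vladimirov_wavelet p ha, sub_sub_cancel, zpow_natCast]
  refine h2.trans ?_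
  rw [Pi.smul_apply, smul_eq_mul, waveletL2, h3]

theorem isVladimirovOn_vladimirovOp {a α : ℂ} (ha : a ≠ 0) (h : ‖a * (p : ℂ) ^ α‖ < 1) :
    IsVladimirovOn p a α (vladimirovOp p a α) := by
  have h := exists_isVladimirovOn p ha h
  rw [vladimirovOp, dif_pos h]
  exact h.choose_spec

/-- The operator is obtained by choice, but its defining property determines it on wavelets. As `|m⟩
= ψ_{1-m}`, the exponent `1 - n` of the eigenvalue becomes `m`. -/
theorem vladimirovOp_ket {a α : ℂ} (ha : a ≠ 0) (h : ‖a * (p : ℂ) ^ α‖ < 1) (m : ℕ) :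
    vladimirovOp p a α (ket p m) = (a * (p : ℂ) ^ α) ^ m • ket p m := by
  refine Subtype.ext (Lp.ext ?_)
  have h1 := Lp.coeFn_smul ((a * (p : ℂ) ^ α) ^ m) (waveletL2 p (1 - m))
  filter_upwards [isVladimirovOn_vladimirovOp p ha h m, h1,
    (memLp_wavelet p (1 - m)).coeFn_toLp] with ξ h2 h3 h4
  rw [h2, vladimirov_wavelet p ha, sub_sub_cancel, zpow_natCast]
  refine Eq.trans ?_ h3.symm
  rw [Pi.smul_apply, smul_eq_mul, waveletL2, h4]

theorem aMinus_pow_ket (j m : ℕ) : (aMinus p ^ j) (ket p m) = ket p (m + j) := by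
  induction j generalizing m with
  | zero => rfl
  | succ j ih => rw [pow_succ, mul_apply_eq_comp, aMinus_ket, ih]; congr 1; lia

theorem aPlus_pow_ket (j m : ℕ) : (aPlus p ^ j) (ket p (m + j)) = ket p m := by
  induction j generalizing m with
  | zero => rfl
  | succ j ih => rw [pow_succ, mul_apply_eq_comp, ← add_assoc, aPlus_ket_succ, ih]

/-- On `|m⟩` the conjugated operator reads the eigenvalue at `|m + j⟩`, which is `c ^ j` times that
at `|m⟩`. -/
theorem aPlus_pow_mul_mul_aMinus_pow {D : HMinus p →L[ℂ] HMinus p} {c : ℂ}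
    (hD : ∀ m, D (ket p m) = c ^ m • ket p m) (j : ℕ) :
    aPlus p ^ j * D * aMinus p ^ j = c ^ j • D := by
  refine clm_ext p fun m => ?_
  rw [mul_apply_eq_comp, mul_apply_eq_comp, aMinus_pow_ket, hD, map_smul,
    aPlus_pow_ket, smul_apply, hD, smul_smul, pow_add, mul_comm]

end Diagonal

/-! ### Traces on the Hilbert tensor product -/

section Tensor
open scoped TensorProduct

theorem tensorOp_coe_tmul {E F : Type} [NormedAddCommGroup E] [InnerProductSpace ℂ E]
    [NormedAddCommGroup F] [InnerProductSpace ℂ F] (A : E →L[ℂ] E) (B : F →L[ℂ] F) (x : E) (y : F) :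
    tensorOp A B ((x ⊗ₜ[ℂ] y : E ⊗[ℂ] F) : HilbertTensor E F) =
      ((A x ⊗ₜ[ℂ] B y : E ⊗[ℂ] F) : HilbertTensor E F) := by
  rw [tensorOp, ContinuousLinearMap.completion_apply_coe, TensorProduct.mapL_tmul]

/-- Bounded operators on the Hilbert tensor product that agree on pure tensors are equal. -/
theorem hilbertTensor_ext {E F G : Type} [NormedAddCommGroup E] [InnerProductSpace ℂ E]
    [NormedAddCommGroup F] [InnerProductSpace ℂ F] [NormedAddCommGroup G] [NormedSpace ℂ G]
    {S T : HilbertTensor E F →L[ℂ] G}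
    (h : ∀ x y, S ((x ⊗ₜ[ℂ] y : E ⊗[ℂ] F) : HilbertTensor E F) =
      T ((x ⊗ₜ[ℂ] y : E ⊗[ℂ] F) : HilbertTensor E F)) : S = T := by
  refine ContinuousLinearMap.ext fun z => ?_
  refine UniformSpace.Completion.induction_on z (isClosed_eq S.continuous T.continuous) fun w => ?_
  induction w using TensorProduct.induction_on with
  | zero => rw [UniformSpace.Completion.coe_zero, map_zero, map_zero]
  | tmul x y => exact h x y
  | add u v hu hv => rw [UniformSpace.Completion.coe_add, map_add, map_add, hu, hv]

theorem tensorOp_smul_smul {E F : Type} [NormedAddCommGroup E] [InnerProductSpace ℂ E]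
    [NormedAddCommGroup F] [InnerProductSpace ℂ F] (A : E →L[ℂ] E) (B : F →L[ℂ] F) (c d : ℂ) :
    tensorOp (c • A) (d • B) = (c * d) • tensorOp A B := by
  refine hilbertTensor_ext fun x y => ?_
  rw [smul_apply, tensorOp_coe_tmul, tensorOp_coe_tmul,
    smul_apply, smul_apply, TensorProduct.smul_tmul_smul,
    UniformSpace.Completion.coe_smul]

section Generic
variable {E F ι κ : Type} [NormedAddCommGroup E] [InnerProductSpace ℂ E] [NormedAddCommGroup F]
  [InnerProductSpace ℂ F] {e : ι → E} {f : κ → F}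

/-- Elementary tensors of two orthonormal systems are orthonormal in the Hilbert tensor product. -/
theorem orthonormal_coe_tmul (he : Orthonormal ℂ e) (hf : Orthonormal ℂ f) :
    Orthonormal ℂ fun k : ι × κ => ((e k.1 ⊗ₜ[ℂ] f k.2 : E ⊗[ℂ] F) : HilbertTensor E F) := by
  classical
  rw [orthonormal_iff_ite] at he hf ⊢
  intro k l
  rw [UniformSpace.Completion.inner_coe, TensorProduct.inner_tmul, he, hf]
  simp only [Prod.ext_iff]
  split_ifs <;> simp_all

/-- Bounded operators that agree on the elementary tensors of two total systems are equal. -/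
theorem hilbertTensor_ext_of_dense {G : Type} [NormedAddCommGroup G] [NormedSpace ℂ G]
    (he : Dense (Submodule.span ℂ (Set.range e) : Set E))
    (hf : Dense (Submodule.span ℂ (Set.range f) : Set F)) {S T : HilbertTensor E F →L[ℂ] G}
    (h : ∀ i j, S ((e i ⊗ₜ[ℂ] f j : E ⊗[ℂ] F) : HilbertTensor E F) =
      T ((e i ⊗ₜ[ℂ] f j : E ⊗[ℂ] F) : HilbertTensor E F)) : S = T := by
  let c := UniformSpace.Completion.toComplL (𝕜 := ℂ) (E := E ⊗[ℂ] F)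
  -- Agreement is extended one variable at a time, using the continuous maps `x ⊗ ·` and `· ⊗ y`.
  let L : E → F →L[ℂ] HilbertTensor E F := fun x => c.comp ⟨TensorProduct.mk ℂ _ _ x,
    TensorProduct.continuous_tmul.comp (continuous_const.prodMk continuous_id)⟩
  let R : F → E →L[ℂ] HilbertTensor E F := fun y => c.comp ⟨(TensorProduct.mk ℂ _ _).flip y,
    TensorProduct.continuous_tmul.comp (continuous_id.prodMk continuous_const)⟩
  have h1 : ∀ i, S.comp (L (e i)) = T.comp (L (e i)) := fun i =>
    ContinuousLinearMap.ext_on hf (by rintro _ ⟨j, rfl⟩; exact h i j)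
  have h2 : ∀ y, S.comp (R y) = T.comp (R y) := fun y =>
    ContinuousLinearMap.ext_on he (by rintro _ ⟨i, rfl⟩; exact DFunLike.congr_fun (h1 i) y)
  exact hilbertTensor_ext fun x y => DFunLike.congr_fun (h2 y) x

/-- The trace of the tensor product of two diagonal operators. -/
theorem hasTrace_tensorOp (he : Orthonormal ℂ e) (hf : Orthonormal ℂ f)
    (hed : Dense (Submodule.span ℂ (Set.range e) : Set E))
    (hfd : Dense (Submodule.span ℂ (Set.range f) : Set F)) {A : E →L[ℂ] E} {B : F →L[ℂ] F}
    {c : ι → ℂ} {d : κ → ℂ} (hc : Summable fun i => ‖c i‖) (hd : Summable fun j => ‖d j‖)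
    {s t : ℂ} (hcs : HasSum c s) (hdt : HasSum d t)
    (hA : ∀ i, A (e i) = c i • e i) (hB : ∀ j, B (f j) = d j • f j) :
    HasTrace (tensorOp A B) (s * t) := by
  have hn : Summable fun k : ι × κ => ‖c k.1 * d k.2‖ := hc.mul_norm hd
  have hs : HasSum (fun k : ι × κ => c k.1 * d k.2) (s * t) := hcs.mul hdt hn.of_norm
  obtain ⟨T, hT, hT'⟩ := exists_clm_of_orthonormal (orthonormal_coe_tmul he hf) hn
  -- The absolutely convergent diagonal operator agrees with `A ⊗ B` on a total system, so `A ⊗ B`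
  -- inherits its rank one expansion.
  have hTAB : T = tensorOp A B := by
    refine hilbertTensor_ext_of_dense hed hfd fun i j => ?_
    rw [hT (i, j), tensorOp_coe_tmul, hA, hB, TensorProduct.smul_tmul_smul,
      UniformSpace.Completion.coe_smul]
  rw [← hTAB]
  exact hasTrace_of_hasSum_rankOne (orthonormal_coe_tmul he hf).1 hn hs hT'

end Generic

variable (p : ℕ) [Fact p.Prime]

/-- Conjugation by the shifts only produces scalars, so the sum is a multiple of `A ⊗ B`, whose
trace is a product of two geometric series. -/
theorem hasTrace_sum_tensorOp {A B : HMinus p →L[ℂ] HMinus p} {c d : ℂ} (hc : ‖c‖ < 1)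
    (hd : ‖d‖ < 1) (hA : ∀ m, A (ket p m) = c ^ m • ket p m)
    (hB : ∀ m, B (ket p m) = d ^ m • ket p m) (l : ℕ) :
    HasTrace (∑ j ∈ Finset.range (l + 1), tensorOp (aPlus p ^ j * A * aMinus p ^ j)
        (aPlus p ^ (l - j) * B * aMinus p ^ (l - j)))
      ((∑ j ∈ Finset.range (l + 1), c ^ j * d ^ (l - j)) * ((1 - c)⁻¹ * (1 - d)⁻¹)) := by
  simp_rw [aPlus_pow_mul_mul_aMinus_pow p hA, aPlus_pow_mul_mul_aMinus_pow p hB,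
    tensorOp_smul_smul, ← Finset.sum_smul]
  exact (hasTrace_tensorOp (orthonormal_ket p) (orthonormal_ket p) (dense_span_ket p)
    (dense_span_ket p) (by simpa using summable_geometric_of_lt_one (norm_nonneg c) hc)
    (by simpa using summable_geometric_of_lt_one (norm_nonneg d) hd)
    (hasSum_geometric_of_norm_lt_one hc) (hasSum_geometric_of_norm_lt_one hd) hA hB).smul _

end Tensor
end PadicHecke

/-! ### The trace formula -/

theorem mainTheorem6 (p : ℕ) [Fact p.Prime] (N : ℕ) [NeZero N] (hpN : ¬ p ∣ N) (k : ℤ)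
    (χ : DirichletCharacter ℂ N)
    (f : CuspForm (CongruenceSubgroup.Gamma1 N : Subgroup (Matrix.GeneralLinearGroup (Fin 2) ℝ)) k)
    (hχ : PadicHecke.HasCharacter χ f) (hf : PadicHecke.IsHeckeEigenform χ f)
    (hf1 : PadicHecke.fourierCoeff f 1 = 1) (a₁ a₂ : ℂ)
    (hadd : a₁ + a₂ = PadicHecke.fourierCoeff f p)
    (hmul : a₁ * a₂ = χ (p : ZMod N) * (p : ℂ) ^ (k - 1)) :
    (∀ s : ℂ, 1 + (k : ℝ) / 2 < s.re →
      ‖a₁ * (p : ℂ) ^ (-s)‖ < 1 ∧ ‖a₂ * (p : ℂ) ^ (-s)‖ < 1) ∧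
    ∀ s : ℂ, ‖a₁ * (p : ℂ) ^ (-s)‖ < 1 → ‖a₂ * (p : ℂ) ^ (-s)‖ < 1 →
      PadicHecke.IsVladimirovOn p a₁ (-s) (PadicHecke.vladimirovOp p a₁ (-s)) ∧
      PadicHecke.IsVladimirovOn p a₂ (-s) (PadicHecke.vladimirovOp p a₂ (-s)) ∧
      ∀ ℓ : ℕ,
        PadicHecke.HasTrace
          (∑ j ∈ Finset.range (ℓ + 1),
            PadicHecke.tensorOp
              (PadicHecke.aPlus p ^ j * PadicHecke.vladimirovOp p a₁ (-s) *
                PadicHecke.aMinus p ^ j)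
              (PadicHecke.aPlus p ^ (ℓ - j) * PadicHecke.vladimirovOp p a₂ (-s) *
                PadicHecke.aMinus p ^ (ℓ - j)))
          (PadicHecke.fourierCoeff f (p ^ ℓ) * (p : ℂ) ^ (-s * ℓ) *
            PadicHecke.localL χ f p s) ∧
        PadicHecke.fourierCoeff f (p ^ ℓ) =
          ∑ j ∈ Finset.range (ℓ + 1), a₁ ^ j * a₂ ^ (ℓ - j) := by
  have hp := (Fact.out : p.Prime)
  have hp0 := PadicHecke.cast_prime_ne_zero p
  have hpR := PadicHecke.cast_prime_pos p
  -- As `p ∤ N`, the value `χ(p)` is nonzero; so both roots are nonzero and the degenerate case `𝔞 =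
  -- 0` of the definitions does not occur.
  have hne : a₁ * a₂ ≠ 0 := by
    rw [hmul]
    refine mul_ne_zero (IsUnit.ne_zero ?_) (zpow_ne_zero _ hp0)
    exact ((ZMod.isUnit_iff_coprime p N).2 ((Nat.Prime.coprime_iff_not_dvd hp).2 hpN)).map χ
  have h₁ : a₁ ≠ 0 := left_ne_zero_of_mul hne
  have h₂ : a₂ ≠ 0 := right_ne_zero_of_mul hne
  have hcoeff := PadicHecke.fourierCoeff_prime_pow hf hf1 hp hadd hmul
  refine ⟨fun s hs => ?_, fun s hs₁ hs₂ => ⟨PadicHecke.isVladimirovOn_vladimirovOp p h₁ hs₁,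
    PadicHecke.isVladimirovOn_vladimirovOp p h₂ hs₂, fun l => ⟨?_, hcoeff l⟩⟩⟩
  · have key : ∀ a : ℂ, ‖a‖ ≤ (p : ℝ) ^ ((k : ℝ) / 2) → ‖a * (p : ℂ) ^ (-s)‖ < 1 := by
      intro a ha
      rw [norm_mul, PadicHecke.norm_cast_prime_cpow, Complex.neg_re]
      calc ‖a‖ * (p : ℝ) ^ (-s.re) ≤ (p : ℝ) ^ ((k : ℝ) / 2) * (p : ℝ) ^ (-s.re) := by gcongr
        _ = (p : ℝ) ^ ((k : ℝ) / 2 + -s.re) := (Real.rpow_add hpR _ _).symm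
        _ < 1 := Real.rpow_lt_one_of_one_lt_of_neg (PadicHecke.one_lt_cast_prime p) (by linarith)
    exact ⟨key _ (PadicHecke.norm_le_of_eigenform hf hf1 hp hadd hmul),
      key _ (PadicHecke.norm_le_of_eigenform hf hf1 hp ((add_comm _ _).trans hadd)
        ((mul_comm _ _).trans hmul))⟩
  · convert PadicHecke.hasTrace_sum_tensorOp p hs₁ hs₂ (PadicHecke.vladimirovOp_ket p h₁ hs₁)
      (PadicHecke.vladimirovOp_ket p h₂ hs₂) l using 1
    -- What remains is the factorisation of the quadratic Euler factor and pulling the common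
    -- `p^(-sℓ)` out of `c₁^j c₂^(ℓ-j)`.
    rw [hcoeff, Finset.sum_mul, ← mul_inv, PadicHecke.localL, ← hadd, ← hmul]
    congr 1
    · refine Finset.sum_congr rfl fun j hj => ?_
      have hj : j + (l - j) = l := Nat.add_sub_cancel' (Finset.mem_range_succ_iff.1 hj)
      rw [Complex.cpow_mul_nat, mul_pow, mul_pow, mul_mul_mul_comm, ← pow_add, hj]
    · congr 1
      rw [show (-2 * s) = -s + -s by ring, Complex.cpow_add _ _ hp0]
      ring
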